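/- **Setting.** Let $L$ be a first-order language, $\kappa>\aleph_0$ a cardinal, and $\mathbb U$ a universal domain: a nonempty $L$-structure such that, for every $A\subseteq\mathbb U$ with $|A|<\kappa$, every complete type over $A$ in finitely many variables is realized in $\mathbb U$, and any two finite tuples with the same type over $A$ are conjugate under $\mathrm{Aut}(\mathbb U/A)$. Let $M\preceq\mathbb U$ be an elementary submodel with $|M|<\kappa$. Let $\tilde G\subseteq\mathbb U^k$ be a group that is ind-definable over $M$ and generated by a subset $X$: for each $n$ the set $(X\cup X^{-1})^{\le n}$ of products of at most $n$ elements of $X\cup X^{-1}$ is $M$-definable, the restriction of the multiplication to it is $M$-definable, and $\tilde G=\bigcup_n (X\cup X^{-1})^{\le n}$. (For example, $\tilde G$ is the subgroup generated by an $M$-definable subset $X$ of an $M$-definable group.) A definable subset of $\tilde G$ is a definable subset of some $(X\cup X^{-1})^{\le n}$; an $\bigwedge$-definable subset of $\tilde G$ over $M$ is an intersection of a nonempty family of $M$-definable subsets of $\tilde G$. **Ideals.** Let $\mu$ be an ideal of $\mathbb U$-definable subsets of $\tilde G$ (it contains $\emptyset$ and is closed under finite unions and under passing to definable subsets) which is *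 $M$-invariant: invariant under $\mathrm{Aut}(\mathbb U/M)$; * S1: for every formula $D(x,y)$ and every $M$-indiscernible sequence $(a_i)_{i\in\mathbb N}$ such that each $D(x,a_i)$ defines a definable subset of $\tilde G$, if $D(x,a_i)\wedge D(x,a_j)\in\mu$ for all $i\ne j$, then $D(x,a_i)\in\mu$ for some $i$; * invariant under left translations and under right translations by all elements of $\tilde G$. A subset of $\tilde G$ (such as the set of realizations of a type) is *wide* if no definable set containing it belongs to $\mu$; in particular a definable subset of $\tilde G$ is non-wide exactly if it is in $\mu$. **Forking.** A formula $\varphi(x,b)$ divides over $M$ if there is an $M$-indiscernible sequence $(b_i)_{i\in\mathbb N}$ of realizations of $\mathrm{tp}(b/M)$ such that $\{\varphi(x,b_i):i\in\mathbb N\}$ is inconsistent; a formula forks over $M$ if it implies a finite disjunction of formulas that divide over $M$; a complete type does not fork over $M$ if none of its formulas forks over $M$. **Theorem (Stabilizer theorem).** Let $q$ be a complete type over $M$, contained in $\tilde G$ and wide; write $q$ also for its set of realizations in $\tilde G$. Assume (F) there are realizations $a,b$ of $q$ such that $\mathrm{tp}(b/Ma)$ does not fork over $M$ and $\mathrm{tp}(a/Mb)$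 does not fork over $M$. Then $S=(q^{-1}q)^2$ is a subgroup of $\tilde G$. It is $\bigwedge$-definable over $M$, wide, and normal in $\tilde G$. The set $qq^{-1}q$ is a coset of $S$. Moreover $S\smallsetminus q^{-1}q$ is contained in a union of non-wide $M$-definable subsets of $\tilde G$. -/

import Mathlib

open FirstOrder FirstOrder.Language Cardinal
open scoped Pointwise

namespace StabilizerThm

universe u v w

variable (L : FirstOrder.Language.{u, v}) {U : Type w} [L.Structure U]

section Types

variable {α : Type*}

/-- The tuples `a` and `b` have the same type over `A`: they satisfy the same formulas with
parameters in `A`. -/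
def SameType (A : Set U) (a b : α → U) : Prop :=
  ∀ φ : L[[A]].Formula α, φ.Realize a ↔ φ.Realize b

/-- Complete types over `A` in the variables `α`: complete types over the theory of `U` in the
language with constants for the elements of `A`. -/
abbrev TypeOver (A : Set U) (α : Type*) :=
  (L[[A]].completeTheory U).CompleteType α

variable {L} in
/-- The set of realizations in `U` of a complete type over `A`. -/
def TypeOver.realizations [Nonempty U] {A : Set U} (q : TypeOver L A α) : Set (α → U) :=
  {a | Theory.typeOf (L[[A]].completeTheory U) a = q}

end Types

/-- `U` is a universal domain for parameter sets of size less than `κ`: every complete type (in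
finitely many variables) over such a set `A` is realized in `U`, and two finite tuples with the
same type over such a set `A` are conjugate under the automorphism group of `U` over `A`. -/
structure IsUniversalDomain (U : Type w) [L.Structure U] [Nonempty U] (κ : Cardinal.{w}) :
    Prop where
  saturated : ∀ A : Set U, #A < κ → ∀ (n : ℕ) (p : TypeOver L A (Fin n)), p.realizations.Nonempty
  homogeneous : ∀ A : Set U, #A < κ → ∀ (n : ℕ) (c d : Fin n → U), SameType L A c d →
    ∃ σ : U ≃[L] U, (∀ a ∈ A, σ a = a) ∧ ∀ i, σ (c i) = d i

section Forking

/-- The sequence `a` of `m`-tuples is indiscernible over `A`: any two increasing finite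
subsequences of the same length have the same type over `A`. -/
def Indiscernible (A : Set U) {m : ℕ} (a : ℕ → Fin m → U) : Prop :=
  ∀ (n : ℕ) (s t : Fin n → ℕ), StrictMono s → StrictMono t →
    SameType L A (fun p : Fin n × Fin m => a (s p.1) p.2) (fun p : Fin n × Fin m => a (t p.1) p.2)

variable {k : ℕ}

/-- The subset of `U ^ k` defined by the formula `φ(x, b)`. -/
def solutionSet {m : ℕ} (φ : L.Formula (Fin k ⊕ Fin m)) (b : Fin m → U) : Set (Fin k → U) :=
  {x | φ.Realize (Sum.elim x b)}

/-- The formula `φ(x, b)` divides over `A`: there is an `A`-indiscernible sequence `(bᵢ)` of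
realizations of `tp(b/A)` such that `{φ(x, bᵢ) : i}` is inconsistent. -/
def DividesOver (A : Set U) {m : ℕ} (φ : L.Formula (Fin k ⊕ Fin m)) (b : Fin m → U) : Prop :=
  ∃ s : ℕ → Fin m → U, Indiscernible L A s ∧ (∀ i, SameType L A (s i) b) ∧
    ⋂ i, solutionSet L φ (s i) = ∅

/-- The definable set `D` forks over `A`: it is covered by finitely many definable sets, each
defined by a formula that divides over `A`. -/
def ForksOver (A : Set U) (D : Set (Fin k → U)) : Prop :=
  ∃ (n : ℕ) (E : Fin n → Set (Fin k → U)),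
    (∀ j, ∃ (m : ℕ) (φ : L.Formula (Fin k ⊕ Fin m)) (b : Fin m → U),
      DividesOver L A φ b ∧ E j = solutionSet L φ b) ∧
    D ⊆ ⋃ j, E j

/-- `tp(b/B)` does not fork over `A`: no formula of `tp(b/B)` forks over `A`. -/
def TypeDoesNotFork (A B : Set U) (b : Fin k → U) : Prop :=
  ∀ D : Set (Fin k → U), B.Definable L D → b ∈ D → ¬ ForksOver L A D

end Forking

section IndDefinable

variable {k : ℕ} {G : Set (Fin k → U)} [Group G]

/-- `(X ∪ X⁻¹)^{≤ n}`: the products of at most `n` elements of `X` and their inverses. -/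
def ball (X : Set G) (n : ℕ) : Set G := (insert 1 (X ∪ X⁻¹)) ^ n

/-- The group `G ⊆ U ^ k`, generated by `X`, is ind-definable over `A`: each of the sets
`(X ∪ X⁻¹)^{≤ n}`, whose union is `G`, is `A`-definable, and so is the (graph of the) restriction
of the multiplication to it. -/
structure IsIndDefinableGroup (A : Set U) (X : Set G) : Prop where
  generates : Subgroup.closure X = ⊤
  definable_ball : ∀ n, A.Definable L ((↑) '' ball X n : Set (Fin k → U))
  definable_mul : ∀ n, A.Definable L {v : Fin 3 × Fin k → U |
    ∃ a ∈ ball X n, ∃ b ∈ ball X n, (fun i => v (0, i)) = (a : Fin k → U) ∧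
      (fun i => v (1, i)) = (b : Fin k → U) ∧ (fun i => v (2, i)) = ((a * b : G) : Fin k → U)}

/-- `D` is an `A`-definable subset of the ind-definable group `G` generated by `X`, that is, an
`A`-definable subset of some `(X ∪ X⁻¹)^{≤ n}`. -/
def IsDefinableSubset (A : Set U) (X : Set G) (D : Set G) : Prop :=
  A.Definable L ((↑) '' D : Set (Fin k → U)) ∧ ∃ n, D ⊆ ball X n

/-- `P` is a `⋀`-definable subset of `G` over `A`: an intersection of `A`-definable subsets
of `G`. -/
def IsTypeDefinable (A : Set U) (X : Set G) (P : Set G) : Prop :=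
  ∃ F : Set (Set G), F.Nonempty ∧ (∀ D ∈ F, IsDefinableSubset L A X D) ∧ P = ⋂₀ F

/-- `μ` is an ideal of the Boolean ring of `U`-definable subsets of `G`. -/
structure IsDefinableIdeal (X : Set G) (μ : Set (Set G)) : Prop where
  definable : ∀ D ∈ μ, IsDefinableSubset L Set.univ X D
  empty_mem : ∅ ∈ μ
  mono : ∀ D ∈ μ, ∀ E, IsDefinableSubset L Set.univ X E → E ⊆ D → E ∈ μ
  union_mem : ∀ D ∈ μ, ∀ E ∈ μ, D ∪ E ∈ μ

/-- `μ` is invariant under the automorphisms of `U` that fix `A` pointwise. -/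
def IsAutInvariant (A : Set U) (μ : Set (Set G)) : Prop :=
  ∀ σ : U ≃[L] U, (∀ a ∈ A, σ a = a) → ∀ D ∈ μ, ∀ E : Set G,
    ((↑) '' E : Set (Fin k → U)) = (fun x i => σ (x i)) '' ((↑) '' D : Set (Fin k → U)) → E ∈ μ

/-- `μ` is invariant under left and right translations by elements of `G`. -/
def IsTranslationInvariant (μ : Set (Set G)) : Prop :=
  ∀ D ∈ μ, ∀ g : G, (fun x => g * x) '' D ∈ μ ∧ (fun x => x * g) '' D ∈ μ

/-- The S1 property, for an ideal `μ` invariant over `A`: if `(aᵢ)` is an `A`-indiscernible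
sequence, the sets `Dᵢ` defined by `φ(x, aᵢ)` are definable subsets of `G`, and `Dᵢ ∩ Dⱼ ∈ μ` for
all `i ≠ j`, then some `Dᵢ` is in `μ`. -/
def IsS1 (A : Set U) (X : Set G) (μ : Set (Set G)) : Prop :=
  ∀ (m : ℕ) (φ : L.Formula (Fin k ⊕ Fin m)) (a : ℕ → Fin m → U) (D : ℕ → Set G),
    Indiscernible L A a →
    (∀ i, IsDefinableSubset L Set.univ X (D i)) →
    (∀ i, ((↑) '' D i : Set (Fin k → U)) = solutionSet L φ (a i)) →
    (∀ i j, i ≠ j → D i ∩ D j ∈ μ) →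
    ∃ i, D i ∈ μ

/-- A subset `P` of `G` (the set of realizations of a partial type) is wide if no definable set
containing `P` is in `μ`. -/
def IsWide (μ : Set (Set G)) (P : Set G) : Prop :=
  ∀ D ∈ μ, ¬ P ⊆ D

end IndDefinable

end StabilizerThm

open StabilizerThm

/-! The model theory enters only through a calculus of sets definable on each ball, with quantifiers
bounded to balls, an elementary submodel and saturation over it. The stabilizer argument takes place
in this setting, and the last parts verify the setting for the given group.

S1 gives two facts. First, a type that is wide over `b` does not divide over the model: along an
indiscernible sequence two translates of a wide set meet in a wide set, and repeating this with
pairs gives arbitrarily large finite intersections. Second, the relation "`φ a ∩ ψ b` is in the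
ideal" is stable: an indiscernible sequence ordering it would give wide sets whose pairwise
intersections are all in the ideal. Hence for fixed types of `a` and `b` over the model, its truth
value is the same for every pair in which one member is independent of the other: wide, or a coheir,
over it. It does not matter which member that is.

Let `stab q` be the set of `g` such that `q` and its right translate by `g⁻¹` meet in a wide set. By
saturation `stab q ⊆ q⁻¹ q`, and `a⁻¹ b ∈ stab q` when `a, b ∈ q` and `b` is wide over `a`. If `h ∈
stab q` is wide over `a, c ∈ q`, stability allows `a` to be replaced by `c` in `h = (h a⁻¹) a`, so
`h a⁻¹ c ∈ stab q`. Iterating, each `g` in a power of `q⁻¹ q` satisfies `h g ∈ stab q` for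
sufficiently generic `h ∈ stab q`. Then `g = h⁻¹ (h g)` lies in `(q⁻¹ q)²`, which is therefore a
group `S` (`pow_subset`). The symmetric form of stability shows that wide elements of `S` are
already in `stab q` (`mem_stab_of_wide`); this gives both the coset statement and the smallness of
`S ∖ q⁻¹ q`.

For normality, S1 applied to translates of `D⁻¹ D` shows that conjugates of `a⁻¹ c` by points of the
model lie in `S` when `c` is a coheir over `a`. Every element is congruent modulo `S` to some `m`
for which the same conclusion holds, which gives arbitrary conjugates. -/

/-- A group with a notion of locally definable subsets of its finite powers: `Def P` means that the
intersection of `P` with each power of a ball is definable over a fixed elementary submodel, whose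
points are `points`. -/
structure LocDefGroup (G : Type*) [Group G] where
  ball : ℕ → Set G
  ball_mono : Monotone ball
  exists_ball : ∀ g, ∃ n, g ∈ ball n
  mul_mem : ∀ m n g h, g ∈ ball m → h ∈ ball n → g * h ∈ ball (m + n)
  inv_mem : ∀ n g, g ∈ ball n → g⁻¹ ∈ ball n
  Def : ∀ {ι : Type}, Set (ι → G) → Prop
  points : Set G
  univ : ∀ {ι : Type} [Finite ι], Def (Set.univ : Set (ι → G))
  inter : ∀ {ι : Type} [Finite ι] (P Q : Set (ι → G)), Def P → Def Q → Def (P ∩ Q)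
  compl : ∀ {ι : Type} [Finite ι] (P : Set (ι → G)), Def P → Def Pᶜ
  comp : ∀ {ι κ : Type} [Finite ι] [Finite κ] (P : Set (ι → G)) (σ : ι → κ), Def P →
    Def {g : κ → G | g ∘ σ ∈ P}
  ex : ∀ {ι κ : Type} [Finite ι] [Finite κ] (n : ℕ) (P : Set (ι ⊕ κ → G)), Def P →
    Def {g : ι → G | ∃ h : κ → G, (∀ j, h j ∈ ball n) ∧ Sum.elim g h ∈ P}
  of_local : ∀ {ι : Type} [Finite ι] (P : Set (ι → G)),
    (∀ n, Def (P ∩ {g | ∀ i, g i ∈ ball n})) → Def P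
  mul_graph : Def {g : Fin 3 → G | g 0 * g 1 = g 2}
  def_ball : ∀ n, Def {g : Unit → G | g () ∈ ball n}
  exists_point : ∀ {ι : Type} [Finite ι] (P : Set (ι → G)), Def P → P.Nonempty →
    ∃ g ∈ P, ∀ i, g i ∈ points
  fiber_point : ∀ {ι κ : Type} [Finite ι] [Finite κ] (P : Set (ι ⊕ κ → G)) (e : κ → G),
    Def P → (∀ j, e j ∈ points) → Def {g : ι → G | Sum.elim g e ∈ P}
  sat : ∀ {ι : Type} [Finite ι] (C : Set G) (n : ℕ) (𝓕 : Set (Set (ι → G))), C.Countable →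
    (∀ Q ∈ 𝓕, ∃ (m : ℕ) (P : Set (ι ⊕ Fin m → G)) (e : Fin m → G), Def P ∧
      (∀ j, e j ∈ points ∪ C) ∧ Q = {g | Sum.elim g e ∈ P}) →
    (∀ t : Set (Set (ι → G)), t.Finite → t ⊆ 𝓕 →
      ∃ g : ι → G, (∀ i, g i ∈ ball n) ∧ ∀ Q ∈ t, g ∈ Q) →
    ∃ g : ι → G, (∀ i, g i ∈ ball n) ∧ ∀ Q ∈ 𝓕, g ∈ Q

/-! ### Definability calculus, types and indiscernible sequences. -/

namespace LocDefGroup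

variable {G : Type*} [Group G] {𝔾 : LocDefGroup G} {ι κ : Type}

/-- `Q` is locally definable over the model and the parameters in `C`. -/
def DefOver (𝔾 : LocDefGroup G) (C : Set G) (Q : Set (ι → G)) : Prop :=
  ∃ (m : ℕ) (P : Set (ι ⊕ Fin m → G)) (e : Fin m → G), 𝔾.Def P ∧
      (∀ j, e j ∈ C) ∧ Q = {g | Sum.elim g e ∈ P}

theorem DefOver.mono {C C' : Set G} {Q : Set (ι → G)} (h : 𝔾.DefOver C Q) (hC : C ⊆ C') :
    𝔾.DefOver C' Q := by
  obtain ⟨m, P, e, h1, h2, h3⟩ := h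
  exact ⟨m, P, e, h1, fun j => hC (h2 j), h3⟩

/-- The tuples `a` and `b` have the same type over the model. -/
def SameTp (𝔾 : LocDefGroup G) (a b : ι → G) : Prop := ∀ P, 𝔾.Def P → (a ∈ P ↔ b ∈ P)

theorem SameTp.refl (a : ι → G) : 𝔾.SameTp a a := fun _ _ => Iff.rfl

theorem SameTp.symm {a b : ι → G} (h : 𝔾.SameTp a b) : 𝔾.SameTp b a := fun P hP => (h P hP).symm

theorem SameTp.trans {a b c : ι → G} (h : 𝔾.SameTp a b) (h' : 𝔾.SameTp b c) : 𝔾.SameTp a c :=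
  fun P hP => (h P hP).trans (h' P hP)

variable [Finite ι] [Finite κ]

theorem Def.inter {P Q : Set (ι → G)} (hP : 𝔾.Def P) (hQ : 𝔾.Def Q) : 𝔾.Def (P ∩ Q) :=
  𝔾.inter _ _ hP hQ

theorem Def.compl {P : Set (ι → G)} (hP : 𝔾.Def P) : 𝔾.Def Pᶜ := 𝔾.compl _ hP

theorem Def.comp {P : Set (ι → G)} (hP : 𝔾.Def P) (σ : ι → κ) :
    𝔾.Def {g : κ → G | g ∘ σ ∈ P} := 𝔾.comp _ _ hP

theorem Def.setOf_forall {α : Type*} [Finite α] {P : α → Set (ι → G)} (hP : ∀ a, 𝔾.Def (P a)) :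
    𝔾.Def {g | ∀ a, g ∈ P a} := by
  have h : ∀ (s : Set α), s.Finite → 𝔾.Def {g : ι → G | ∀ a ∈ s, g ∈ P a} := by
    intro s hs
    induction s, hs using Set.Finite.induction_on with
    | empty => simpa using 𝔾.univ
    | @insert a s _ _ ih =>
      convert (hP a).inter ih using 1
      ext g; simp
  simpa using h Set.univ Set.finite_univ

theorem Def.setOf_forall_mem {α : Type*} {s : Set α} (hs : s.Finite) {P : α → Set (ι → G)}
    (hP : ∀ a ∈ s, 𝔾.Def (P a)) : 𝔾.Def {g | ∀ a ∈ s, g ∈ P a} := by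
  have := hs.to_subtype
  have := Def.setOf_forall (𝔾 := 𝔾) (α := s) (P := fun a => P a) fun a => hP a a.2
  simpa using this

theorem def_mem_ball (i : ι) (n : ℕ) : 𝔾.Def {g : ι → G | g i ∈ 𝔾.ball n} :=
  𝔾.comp _ (fun _ : Unit => i) (𝔾.def_ball n)

theorem def_eq (i j : ι) : 𝔾.Def {g : ι → G | g i = g j} := by
  obtain ⟨n, hn⟩ := 𝔾.exists_ball 1
  -- Equality is read off the graph of multiplication: `h * h = h` forces `h = 1`, and then `g i * h
  -- = g j` says `g i = g j`.
  have h := 𝔾.ex n (ι := ι) (κ := Unit) _ ((𝔾.mul_graph.comp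
    ![Sum.inr (), Sum.inr (), Sum.inr ()]).inter
    (𝔾.mul_graph.comp ![Sum.inl i, Sum.inr (), Sum.inl j]))
  convert h using 1
  ext g
  simp only [Set.mem_ofPred_eq, Set.mem_inter_iff, Function.comp_apply, Matrix.cons_val_zero,
    Matrix.cons_val_one, Matrix.cons_val, Sum.elim_inl, Sum.elim_inr]
  refine ⟨fun h => ⟨fun _ => 1, fun _ => hn, mul_one 1, by simpa using h⟩, ?_⟩
  rintro ⟨h, -, h1, h2⟩
  simpa [mul_eq_left.1 h1] using h2

/-- `f` is a locally definable function which maps balls into balls. -/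
def DFun (𝔾 : LocDefGroup G) (f : (ι → G) → G) : Prop :=
  (∀ n, ∃ N, ∀ g : ι → G, (∀ i, g i ∈ 𝔾.ball n) → f g ∈ 𝔾.ball N) ∧
    𝔾.Def {v : ι ⊕ Unit → G | v (Sum.inr ()) = f (v ∘ Sum.inl)}

theorem DFun.proj (i : ι) : 𝔾.DFun (fun g : ι → G => g i) :=
  ⟨fun n => ⟨n, fun _ h => h i⟩, def_eq _ _⟩

/-- On tuples from one ball the values of all `f j` stay in a common ball, so substitution is a
bounded existential over the graphs; `of_local` then puts the balls together. -/
theorem Def.subst {P : Set (κ → G)} (hP : 𝔾.Def P) {f : κ → (ι → G) → G}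
    (hf : ∀ j, 𝔾.DFun (f j)) : 𝔾.Def {g : ι → G | (fun j => f j g) ∈ P} := by
  refine 𝔾.of_local _ fun n => ?_
  choose N hN using fun j => (hf j).1 n
  obtain ⟨N', hN'⟩ := (Set.finite_range N).bddAbove
  have h1 : 𝔾.Def {w : ι ⊕ κ → G | ∀ j, w ∈ {w : ι ⊕ κ → G | w (Sum.inr j) = f j (w ∘ Sum.inl)}} :=
    Def.setOf_forall fun j => (hf j).2.comp (Sum.map id fun _ => j)
  have h2 := (𝔾.ex N' _ (h1.inter (hP.comp Sum.inr))).inter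
    (Def.setOf_forall fun i : ι => def_mem_ball i n)
  convert h2 using 1
  ext g
  simp only [Set.mem_inter_iff, Set.mem_ofPred_eq, and_congr_left_iff]
  intro hg
  constructor
  · intro h
    exact ⟨fun j => f j g, fun j => 𝔾.ball_mono (hN' ⟨j, rfl⟩) (hN j g hg), fun j => by simp, h⟩
  · rintro ⟨h, -, h1, h2⟩
    have : h = fun j => f j g := by
      ext j; simpa using h1 j
    subst this
    exact h2

theorem DFun.comp {f : (ι → G) → G} (hf : 𝔾.DFun f) (σ : ι → κ) :
    𝔾.DFun (fun g : κ → G => f (g ∘ σ)) :=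
  ⟨fun n => (hf.1 n).imp fun _ h _ hg => h _ fun _ => hg _, hf.2.comp (Sum.map σ id)⟩

theorem DFun.mul {f g : (ι → G) → G} (hf : 𝔾.DFun f) (hg : 𝔾.DFun g) :
    𝔾.DFun (fun x => f x * g x) := by
  refine ⟨fun n => ?_, ?_⟩
  · obtain ⟨N, hN⟩ := hf.1 n
    obtain ⟨N', hN'⟩ := hg.1 n
    exact ⟨N + N', fun x hx => 𝔾.mul_mem _ _ _ _ (hN x hx) (hN' x hx)⟩
  · have := 𝔾.mul_graph.subst (f := ![fun v : ι ⊕ Unit → G => f (v ∘ Sum.inl),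
      fun v => g (v ∘ Sum.inl), fun v => v (Sum.inr ())]) (by
        intro j
        fin_cases j
        · exact hf.comp Sum.inl
        · exact hg.comp Sum.inl
        · exact DFun.proj _)
    convert this using 1
    ext v
    simp [eq_comm]

theorem DFun.preimage {f : (ι → G) → G} (hf : 𝔾.DFun f) {s : Set G}
    (hs : 𝔾.Def {v : Unit → G | v () ∈ s}) : 𝔾.Def {g | f g ∈ s} :=
  hs.subst (f := fun _ => f) fun _ => hf

theorem def_one : 𝔾.Def {v : Unit → G | v () ∈ ({1} : Set G)} := by
  convert 𝔾.mul_graph.comp (fun _ => ()) using 1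
  ext v; simp

theorem DFun.inv {f : (ι → G) → G} (hf : 𝔾.DFun f) : 𝔾.DFun (fun x => (f x)⁻¹) := by
  refine ⟨fun n => ?_, ?_⟩
  · obtain ⟨N, hN⟩ := hf.1 n
    exact ⟨N, fun x hx => 𝔾.inv_mem _ _ (hN x hx)⟩
  · have := ((DFun.proj (Sum.inr ())).mul (hf.comp Sum.inl)).preimage (𝔾 := 𝔾) def_one
    convert this using 1
    ext v
    simp [eq_inv_iff_mul_eq_one]

theorem Def.defOver {C : Set G} {P : Set (ι ⊕ κ → G)} (hP : 𝔾.Def P) (e : κ → G)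
    (he : ∀ j, e j ∈ C) : 𝔾.DefOver C {g : ι → G | Sum.elim g e ∈ P} := by
  obtain ⟨m, ⟨σ⟩⟩ := Finite.exists_equiv_fin κ
  refine ⟨m, _, e ∘ σ.symm, hP.comp (Sum.map id σ), fun j => he _, ?_⟩
  ext g
  simp only [Set.mem_ofPred_eq]
  rw [Sum.elim_comp_map, Function.comp_assoc]
  simp

theorem Def.defOver_self {P : Set (ι → G)} (hP : 𝔾.Def P) (C : Set G) : 𝔾.DefOver C P :=
  (hP.comp Sum.inl).defOver (κ := Empty) (Empty.elim) fun j => j.elim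

theorem DefOver.def_of_empty {Q : Set (ι → G)} (h : 𝔾.DefOver ∅ Q) : 𝔾.Def Q := by
  obtain ⟨m, P, e, h1, h2, rfl⟩ := h
  exact 𝔾.fiber_point _ _ h1 fun j => (h2 j).elim

theorem DefOver.subst {C : Set G} {Q : Set (κ → G)} (hQ : 𝔾.DefOver C Q) {δ : Type} [Finite δ]
    {e : δ → G} (he : ∀ d, e d ∈ C) {f : κ → (ι ⊕ δ → G) → G} (hf : ∀ j, 𝔾.DFun (f j)) :
    𝔾.DefOver C {g : ι → G | (fun j => f j (Sum.elim g e)) ∈ Q} := by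
  obtain ⟨m, P, e', h1, h2, rfl⟩ := hQ
  have := (h1.subst (ι := ι ⊕ (δ ⊕ Fin m))
    (f := Sum.elim (fun j w => f j (w ∘ Sum.map id Sum.inl)) (fun j w => w (Sum.inr (Sum.inr j))))
    (by rintro (j | j)
        · exact (hf j).comp _
        · exact DFun.proj _)).defOver (C := C) (Sum.elim e e')
    (by rintro (j | j)
        · exact he j
        · exact h2 j)
  convert this using 1
  ext g
  simp only [Set.mem_ofPred_eq]
  refine iff_of_eq (congrArg (· ∈ P) ?_)
  ext (j | j)
  · simp [Sum.elim_comp_map]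
  · simp

theorem SameTp.subst {a b : ι → G} (h : 𝔾.SameTp a b) {f : κ → (ι → G) → G}
    (hf : ∀ j, 𝔾.DFun (f j)) : 𝔾.SameTp (fun j => f j a) (fun j => f j b) :=
  fun _ hP => h _ (hP.subst hf)

theorem SameTp.comp {a b : ι → G} (h : 𝔾.SameTp a b) (σ : κ → ι) :
    𝔾.SameTp (a ∘ σ) (b ∘ σ) := fun _ hP => h _ (hP.comp σ)

theorem exists_ball_forall (g : ι → G) : ∃ n, ∀ i, g i ∈ 𝔾.ball n := by
  choose N hN using fun i => 𝔾.exists_ball (g i)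
  obtain ⟨N', hN'⟩ := (Set.finite_range N).bddAbove
  exact ⟨N', fun i => 𝔾.ball_mono (hN' ⟨i, rfl⟩) (hN i)⟩

/-- The sequence `b` of tuples is indiscernible over the model. -/
def Indisc (𝔾 : LocDefGroup G) {β : Type} (b : ℕ → β → G) : Prop :=
  ∀ (n : ℕ) (s t : Fin n → ℕ), StrictMono s → StrictMono t →
    𝔾.SameTp (fun p : Fin n × β => b (s p.1) p.2) (fun p : Fin n × β => b (t p.1) p.2)

theorem Indisc.sameTp {β : Type} [Finite β] {b : ℕ → β → G} (hb : 𝔾.Indisc b) (i j : ℕ) :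
    𝔾.SameTp (b i) (b j) :=
  (hb 1 (fun _ => i) (fun _ => j) (Subsingleton.strictMono _) (Subsingleton.strictMono _)).comp
    (fun x : β => ((0 : Fin 1), x))

theorem Indisc.sameTp_pair {β : Type} [Finite β] {b : ℕ → β → G} (hb : 𝔾.Indisc b)
    {i j i' j' : ℕ} (h : i < j) (h' : i' < j') :
    𝔾.SameTp (Sum.elim (b i) (b j)) (Sum.elim (b i') (b j')) := by
  have := (hb 2 ![i, j] ![i', j'] (by simpa using h) (by simpa using h')).comp
    (Sum.elim (fun x : β => ((0 : Fin 2), x)) (fun x : β => ((1 : Fin 2), x)))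
  convert this using 1 <;> ext (x | x) <;> rfl

theorem Indisc.comp {β γ : Type} [Finite β] [Finite γ] {b : ℕ → β → G} (hb : 𝔾.Indisc b)
    (σ : γ → β) : 𝔾.Indisc (fun i => b i ∘ σ) := fun n s t hs ht =>
  (hb n s t hs ht).comp (Prod.map id σ)

/-- The sequence of pairs of consecutive terms. -/
def pairs {β : Type} (b : ℕ → β → G) (i : ℕ) : Fin 2 × β → G := fun p => b (2 * i + p.1) p.2

theorem Indisc.pairs {β : Type} [Finite β] {b : ℕ → β → G} (hb : 𝔾.Indisc b) :
    𝔾.Indisc (pairs b) := by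
  intro n s t hs ht
  -- Listing the two members of each pair in order keeps the indices increasing, so `n` pairs become
  -- an increasing sequence of length `n * 2`.
  have key : ∀ s : Fin n → ℕ, StrictMono s →
      StrictMono (fun i : Fin (n * 2) => 2 * s (finProdFinEquiv.symm i).1 +
        ((finProdFinEquiv.symm i).2 : ℕ)) := by
    intro s hs i j hij
    obtain ⟨⟨i1, i2⟩, rfl⟩ := finProdFinEquiv.surjective i
    obtain ⟨⟨j1, j2⟩, rfl⟩ := finProdFinEquiv.surjective j
    simp only [Equiv.symm_apply_apply]
    have hij' : (i2 : ℕ) + 2 * i1 < j2 + 2 * j1 := hij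
    rcases lt_trichotomy i1 j1 with h | h | h
    · have := hs h
      omega
    · subst h; omega
    · have : (j1 : ℕ) < i1 := h
      omega
  have := (hb (n * 2) _ _ (key s hs) (key t ht)).comp
    (fun p : Fin n × (Fin 2 × β) => (finProdFinEquiv (p.1, p.2.1), p.2.2))
  simpa [Function.comp_def, LocDefGroup.pairs, -finProdFinEquiv_symm_apply] using this

end LocDefGroup

/-- A sequence of values of type `α` obtained by choosing each `f n` with the property
`P n (f 0, …, f (n - 1))`. -/
theorem exists_seq_of_forall_fin {α : Type*} (P : ∀ n : ℕ, (Fin n → α) → α → Prop)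
    (h : ∀ (n : ℕ) (f : Fin n → α),
      (∀ i : Fin n, P i (fun j => f (j.castLE i.2.le)) (f i)) → ∃ x, P n f x) :
    ∃ c : ℕ → α, ∀ n, P n (fun i => c i) (c n) := by
  have : Nonempty α := ⟨(h 0 Fin.elim0 fun i => i.elim0).choose⟩
  -- A next value is guaranteed only after a good prefix, so the recursion chooses by `epsilon` and
  -- goodness is proved afterwards by strong induction.
  let c : ℕ → α := Nat.strongRec fun n ih => Classical.epsilon (P n fun i => ih i i.2)
  have hc : ∀ n, c n = Classical.epsilon (P n fun i => c i) := fun n => Nat.strongRec_eq _ n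
  refine ⟨c, fun n => ?_⟩
  induction n using Nat.strong_induction_on with
  | _ n ih =>
    have := h n (fun i => c i) fun i => ih i i.2
    rw [hc n]
    exact Classical.epsilon_spec this

/-! ### Average types, Morley sequences, coheirs and non-dividing. -/

namespace LocDefGroup

variable {G : Type*} [Group G] {𝔾 : LocDefGroup G} {ι κ β : Type}

/-- The tuple `d` realizes the average type of `𝒰` over `C`. -/
def RealizesAv (𝔾 : LocDefGroup G) (𝒰 : Ultrafilter (β → G)) (C : Set G) (d : β → G) : Prop :=
  ∀ (m : ℕ) (P : Set (β ⊕ Fin m → G)) (e : Fin m → G), 𝔾.Def P → (∀ j, e j ∈ C) →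
    (Sum.elim d e ∈ P ↔ ∀ᶠ g in 𝒰, Sum.elim g e ∈ P)

theorem RealizesAv.mono {𝒰 : Ultrafilter (β → G)} {C C' : Set G} {d : β → G}
    (h : 𝔾.RealizesAv 𝒰 C d) (hC : C' ⊆ C) : 𝔾.RealizesAv 𝒰 C' d :=
  fun m P e hP he => h m P e hP fun j => hC (he j)

/-- The terms of the tuples `d 0, …, d (n - 1)`. -/
def prev (d : ℕ → β → G) (n : ℕ) : Set G := {x | ∃ i < n, ∃ j, d i j = x}

variable [Finite ι] [Finite κ] [Finite β]

theorem RealizesAv.iff {𝒰 : Ultrafilter (β → G)} {C : Set G} {d : β → G}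
    (h : 𝔾.RealizesAv 𝒰 C d) {P : Set (β ⊕ κ → G)} (hP : 𝔾.Def P) {e : κ → G}
    (he : ∀ j, e j ∈ C) : Sum.elim d e ∈ P ↔ ∀ᶠ g in 𝒰, Sum.elim g e ∈ P := by
  obtain ⟨m, ⟨σ⟩⟩ := Finite.exists_equiv_fin κ
  have := h m _ (e ∘ σ.symm) (hP.comp (Sum.map id σ)) fun j => he _
  simpa [Sum.elim_comp_map, Function.comp_assoc] using this

theorem RealizesAv.iff_self {𝒰 : Ultrafilter (β → G)} {C : Set G} {d : β → G}
    (h : 𝔾.RealizesAv 𝒰 C d) {P : Set (β → G)} (hP : 𝔾.Def P) : d ∈ P ↔ ∀ᶠ g in 𝒰, g ∈ P := by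
  have := h.iff (hP.comp Sum.inl) (κ := Empty) (e := Empty.elim) fun j => j.elim
  simpa using this

theorem exists_realizesAv {𝒰 : Ultrafilter (β → G)} {n : ℕ}
    (hn : ∀ᶠ g : β → G in 𝒰, ∀ i, g i ∈ 𝔾.ball n) {C : Set G} (hC : C.Countable) :
    ∃ d, 𝔾.RealizesAv 𝒰 (𝔾.points ∪ C) d := by
  obtain ⟨d, -, hd⟩ := 𝔾.sat C n
    {Q : Set (β → G) | 𝔾.DefOver (𝔾.points ∪ C) Q ∧ ∀ᶠ g in 𝒰, g ∈ Q} hC (fun Q hQ => hQ.1) (by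
      intro t ht hts
      have h1 : ∀ᶠ g in 𝒰, ∀ Q ∈ t, g ∈ Q :=
        (Filter.eventually_all_finite ht).2 fun Q hQ => (hts hQ).2
      exact (hn.and h1).exists)
  have key : ∀ (m : ℕ) (P : Set (β ⊕ Fin m → G)) (e : Fin m → G), 𝔾.Def P →
      (∀ j, e j ∈ 𝔾.points ∪ C) → (∀ᶠ g in 𝒰, Sum.elim g e ∈ P) → Sum.elim d e ∈ P :=
    fun m P e hP he h => hd {g | Sum.elim g e ∈ P} ⟨hP.defOver e he, h⟩
  refine ⟨d, fun m P e hP he => ⟨fun h => ?_, key m P e hP he⟩⟩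
  by_contra h'
  exact key m _ e hP.compl he (Ultrafilter.eventually_not.2 h') h

/-- The sequence `d` is a Morley sequence of the average type of `𝒰` over the model and `C`. -/
def IsMorley (𝔾 : LocDefGroup G) (𝒰 : Ultrafilter (β → G)) (C : Set G) (d : ℕ → β → G) : Prop :=
  ∀ n, 𝔾.RealizesAv 𝒰 (𝔾.points ∪ (C ∪ prev d n)) (d n)

/-- Needed because non-dividing speaks of infinite sequences, while the constructions below hold
only a finite initial segment at each stage. -/
theorem exists_isMorley_extend {𝒰 : Ultrafilter (β → G)} {n : ℕ}
    (hn : ∀ᶠ g : β → G in 𝒰, ∀ i, g i ∈ 𝔾.ball n) {C : Set G} (hC : C.Countable) (N : ℕ) (g : ℕ → β → G)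
    (hg : ∀ i < N, 𝔾.RealizesAv 𝒰 (𝔾.points ∪ (C ∪ prev g i)) (g i)) :
    ∃ d, 𝔾.IsMorley 𝒰 C d ∧ ∀ i < N, d i = g i := by
  obtain ⟨c, hc⟩ := exists_seq_of_forall_fin
    (fun m (f : Fin m → β → G) x => 𝔾.RealizesAv 𝒰 (𝔾.points ∪ (C ∪ {y | ∃ i : Fin m, ∃ j : β, f i j = y})) x ∧
      (m < N → x = g m)) (by
    intro m f hf
    by_cases hm : m < N
    · refine ⟨g m, ?_, fun _ => rfl⟩
      convert hg m hm using 4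
      ext y
      constructor
      · rintro ⟨i, j, rfl⟩
        exact ⟨i, i.2, j, by rw [(hf i).2 (i.2.trans hm)]⟩
      · rintro ⟨i, hi, j, rfl⟩
        exact ⟨⟨i, hi⟩, j, by rw [(hf ⟨i, hi⟩).2 (hi.trans hm)]⟩
    · have : (C ∪ {y | ∃ i : Fin m, ∃ j : β, f i j = y}).Countable := by
        refine hC.union ?_
        convert Set.countable_range (fun p : Fin m × β => f p.1 p.2) using 1
        ext y; simp
      obtain ⟨d, hd⟩ := exists_realizesAv hn this
      exact ⟨d, hd, fun h => absurd h hm⟩)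
  refine ⟨c, fun m => ?_, fun i hi => (hc i).2 hi⟩
  convert (hc m).1 using 4
  ext y
  constructor
  · rintro ⟨i, hi, j, rfl⟩
    exact ⟨⟨i, hi⟩, j, rfl⟩
  · rintro ⟨i, j, rfl⟩
    exact ⟨i, i.2, j, rfl⟩

theorem exists_isMorley {𝒰 : Ultrafilter (β → G)} {n : ℕ}
    (hn : ∀ᶠ g : β → G in 𝒰, ∀ i, g i ∈ 𝔾.ball n) {C : Set G} (hC : C.Countable) :
    ∃ d, 𝔾.IsMorley 𝒰 C d :=
  (exists_isMorley_extend hn hC 0 (fun _ _ => 1) fun _ hi => absurd hi (Nat.not_lt_zero _)).imp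
    fun _ h => h.1

/-- The last term can be replaced by an `𝒰`-generic tuple `g` from the base, which becomes a further
parameter. Induction on the length then applies, since `e` ranges over all tuples of the base. -/
theorem IsMorley.sumElim_mem_iff {𝒰 : Ultrafilter (β → G)} {C : Set G} {d : ℕ → β → G}
    (hd : 𝔾.IsMorley 𝒰 C d) (h𝒰 : ∀ᶠ g : β → G in 𝒰, ∀ i, g i ∈ 𝔾.points ∪ C) (n : ℕ) :
    ∀ {κ : Type} [Finite κ] (P : Set ((Fin n × β) ⊕ κ → G)) (e : κ → G) (s t : Fin n → ℕ),
      𝔾.Def P → (∀ j, e j ∈ 𝔾.points ∪ C) → StrictMono s → StrictMono t →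
      (Sum.elim (fun p : Fin n × β => d (s p.1) p.2) e ∈ P ↔
        Sum.elim (fun p : Fin n × β => d (t p.1) p.2) e ∈ P) := by
  induction n with
  | zero =>
    intro κ _ P e s t _ _ _ _
    have : s = t := Subsingleton.elim _ _
    rw [this]
  | succ n ih =>
    intro κ _ P e s t hP he hs ht
    let τ : (Fin (n + 1) × β) ⊕ κ → β ⊕ ((Fin n × β) ⊕ κ) :=
      Sum.elim (fun p => Fin.lastCases (motive := fun _ => β ⊕ ((Fin n × β) ⊕ κ)) (Sum.inl p.2)
        (fun i => Sum.inr (Sum.inl (i, p.2))) p.1) (fun j => Sum.inr (Sum.inr j))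
    let ρ : (β ⊕ ((Fin n × β) ⊕ κ)) → (Fin n × β) ⊕ (β ⊕ κ) :=
      Sum.elim (fun x => Sum.inr (Sum.inl x)) (Sum.elim Sum.inl fun j => Sum.inr (Sum.inr j))
    have hτ : ∀ s : Fin (n + 1) → ℕ, Sum.elim (fun p : Fin (n + 1) × β => d (s p.1) p.2) e =
        Sum.elim (d (s (Fin.last n)))
          (Sum.elim (fun p : Fin n × β => d (s p.1.castSucc) p.2) e) ∘ τ := by
      intro s
      ext (⟨i, x⟩ | j)
      · induction i using Fin.lastCases <;> simp [τ]
      · simp [τ]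
    have step : ∀ s : Fin (n + 1) → ℕ, StrictMono s →
        (Sum.elim (fun p : Fin (n + 1) × β => d (s p.1) p.2) e ∈ P ↔
          ∀ᶠ g in 𝒰, Sum.elim (fun p : Fin n × β => d (s p.1.castSucc) p.2) (Sum.elim g e) ∈
            {w | w ∘ ρ ∘ τ ∈ P}) := by
      intro s hs
      rw [hτ]
      refine ((hd (s (Fin.last n))).iff (hP.comp τ) ?_).trans (iff_of_eq ?_)
      · rintro (⟨i, x⟩ | j)
        · exact Or.inr (Or.inr ⟨_, hs (Fin.castSucc_lt_last i), _, rfl⟩)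
        · exact (he j).imp id Or.inl
      · congr 1
        ext g
        simp only [Set.mem_ofPred_eq]
        refine iff_of_eq (congrArg (· ∈ P) ?_)
        rw [← Function.comp_assoc]
        congr 1
        ext (x | x | x) <;> rfl
    rw [step s hs, step t ht]
    refine Filter.eventually_congr (h𝒰.mono fun g hg => ?_)
    refine ih _ (Sum.elim g e) (fun i => s i.castSucc) (fun i => t i.castSucc) (hP.comp (ρ ∘ τ)) ?_
      (hs.comp Fin.strictMono_castSucc) (ht.comp Fin.strictMono_castSucc)
    rintro (j | j)
    · exact hg j
    · exact he j

theorem IsMorley.indisc {𝒰 : Ultrafilter (β → G)} {C : Set G} {d : ℕ → β → G}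
    (hd : 𝔾.IsMorley 𝒰 C d) (h𝒰 : ∀ᶠ g : β → G in 𝒰, ∀ i, g i ∈ 𝔾.points ∪ C) : 𝔾.Indisc d := by
  intro n s t hs ht P hP
  have := hd.sumElim_mem_iff h𝒰 n (κ := Empty) _ Empty.elim s t (hP.comp Sum.inl)
    (fun j => j.elim) hs ht
  simpa using this

/-- The ultrafilter `𝒰` on the points of the model has the type of `b` as its average type over
the model. -/
def IsCoheir (𝔾 : LocDefGroup G) (𝒰 : Ultrafilter (β → G)) (b : β → G) : Prop :=
  (∀ᶠ g : β → G in 𝒰, ∀ j, g j ∈ 𝔾.points) ∧ ∀ P, 𝔾.Def P → b ∈ P → ∀ᶠ g in 𝒰, g ∈ P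

/-- Each definable set containing `b` has a point in the model, so these sets, restricted to model
points, generate a proper filter. -/
theorem exists_isCoheir (b : β → G) : ∃ 𝒰, 𝔾.IsCoheir 𝒰 b := by
  let F : Filter (β → G) :=
    { sets := {s | ∃ P, 𝔾.Def P ∧ b ∈ P ∧ ∀ g ∈ P, (∀ j, g j ∈ 𝔾.points) → g ∈ s}
      univ_sets := ⟨_, 𝔾.univ, trivial, fun _ _ _ => trivial⟩
      sets_of_superset := fun {_ _} ⟨P, h1, h2, h3⟩ h => ⟨P, h1, h2, fun g hg hg' => h (h3 g hg hg')⟩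
      inter_sets := fun {_ _} ⟨P, h1, h2, h3⟩ ⟨Q, h1', h2', h3'⟩ =>
        ⟨_, h1.inter h1', ⟨h2, h2'⟩, fun g hg hg' => ⟨h3 g hg.1 hg', h3' g hg.2 hg'⟩⟩ }
  have : F.NeBot := by
    rw [Filter.neBot_iff, ne_eq, ← Filter.empty_mem_iff_bot]
    rintro ⟨P, h1, h2, h3⟩
    obtain ⟨g, hg, hg'⟩ := 𝔾.exists_point P h1 ⟨b, h2⟩
    exact h3 g hg hg'
  refine ⟨Ultrafilter.of F, Ultrafilter.of_le F ?_, fun P hP hb => Ultrafilter.of_le F ?_⟩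
  · exact ⟨_, 𝔾.univ, trivial, fun _ _ h => h⟩
  · exact ⟨P, hP, hb, fun _ h _ => h⟩

theorem IsCoheir.exists_ball {𝒰 : Ultrafilter (β → G)} {b : β → G} (h : 𝔾.IsCoheir 𝒰 b) :
    ∃ n, ∀ᶠ g : β → G in 𝒰, ∀ i, g i ∈ 𝔾.ball n := by
  obtain ⟨n, hn⟩ := exists_ball_forall (𝔾 := 𝔾) b
  exact ⟨n, h.2 _ (Def.setOf_forall fun i => def_mem_ball i n) hn⟩

theorem IsCoheir.eventually_mem_iff {𝒰 : Ultrafilter (β → G)} {b : β → G} (h : 𝔾.IsCoheir 𝒰 b)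
    {P : Set (β → G)} (hP : 𝔾.Def P) : (∀ᶠ g in 𝒰, g ∈ P) ↔ b ∈ P := by
  refine ⟨fun h' => ?_, h.2 P hP⟩
  by_contra hb
  obtain ⟨g, hg, hg'⟩ := (h'.and (h.2 _ hP.compl hb)).exists
  exact hg' hg

theorem IsCoheir.sameTp {𝒰 : Ultrafilter (β → G)} {b d : β → G} {C : Set G}
    (h : 𝔾.IsCoheir 𝒰 b) (hd : 𝔾.RealizesAv 𝒰 C d) : 𝔾.SameTp d b := fun _ hP =>
  (hd.iff_self hP).trans (h.eventually_mem_iff hP)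

/-- Coheirs are invariant: membership is decided by tuples `g` of model points, and `e`, `e'`
satisfy the same conditions with such a `g` as parameter. -/
theorem IsCoheir.sameTp_sumElim {𝒰 : Ultrafilter (β → G)} {b d d' : β → G} {C C' : Set G}
    (h : 𝔾.IsCoheir 𝒰 b) (hd : 𝔾.RealizesAv 𝒰 C d) (hd' : 𝔾.RealizesAv 𝒰 C' d')
    {e e' : κ → G} (he : ∀ j, e j ∈ C) (he' : ∀ j, e' j ∈ C') (hee : 𝔾.SameTp e e') :
    𝔾.SameTp (Sum.elim d e) (Sum.elim d' e') := by
  intro P hP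
  rw [hd.iff hP he, hd'.iff hP he']
  refine Filter.eventually_congr (h.1.mono fun g hg => ?_)
  have := hee _ (𝔾.fiber_point (ι := κ) (κ := β) _ g (hP.comp (Sum.swap)) hg)
  simp only [Set.mem_ofPred_eq] at this
  convert this using 2 <;> ext (x | x) <;> rfl

/-- The type of `a` over the model and `b` does not divide over the model. -/
def NonDividing (𝔾 : LocDefGroup G) (a b : G) : Prop :=
  ∀ s : ℕ → Unit → G, 𝔾.Indisc s → (∀ i, 𝔾.SameTp (s i) (fun _ => b)) →
    ∃ a', ∀ i, 𝔾.SameTp ![a', s i ()] ![a, b]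

theorem sameTp_swap {a b a' b' : G} (h : 𝔾.SameTp ![a, b] ![a', b']) :
    𝔾.SameTp ![b, a] ![b', a'] := by
  have := h.comp ![1, 0]
  convert this using 1 <;> ext i <;> fin_cases i <;> rfl

theorem sameTp_fst {a b a' b' : G} (h : 𝔾.SameTp ![a, b] ![a', b']) :
    𝔾.SameTp (fun _ : Unit => a) (fun _ => a') := h.comp fun _ => 0

theorem IsCoheir.sameTp_pair {𝒰 : Ultrafilter (Unit → G)} {b d d' : Unit → G} {C C' : Set G}
    (h : 𝔾.IsCoheir 𝒰 b) (hd : 𝔾.RealizesAv 𝒰 C d) (hd' : 𝔾.RealizesAv 𝒰 C' d')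
    {a a' : G} (ha : a ∈ C) (ha' : a' ∈ C')
    (haa : 𝔾.SameTp (fun _ : Unit => a) (fun _ => a')) :
    𝔾.SameTp ![a, d ()] ![a', d' ()] := by
  have := (h.sameTp_sumElim hd hd' (e := fun _ : Unit => a) (e' := fun _ => a') (fun _ => ha)
    (fun _ => ha') haa).comp ![Sum.inr (), Sum.inl ()]
  convert this using 1 <;> ext i <;> fin_cases i <;> rfl

/-- A realization of the same average over the whole sequence `s` works for all its terms at once,
by invariance of the coheir. -/
theorem IsCoheir.nonDividing {𝒰 : Ultrafilter (Unit → G)} {a₀ : Unit → G} {a b : G}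
    (h : 𝔾.IsCoheir 𝒰 a₀) (ha : 𝔾.RealizesAv 𝒰 (𝔾.points ∪ {b}) fun _ => a) :
    𝔾.NonDividing a b := by
  intro s _ hsb
  obtain ⟨n, hn⟩ := h.exists_ball
  obtain ⟨d, hd⟩ := exists_realizesAv hn (Set.countable_range fun i => s i ())
  exact ⟨d (), fun i => sameTp_swap (h.sameTp_pair hd ha (Or.inr ⟨i, rfl⟩) (Or.inr rfl) (hsb i))⟩

/-- The second coordinates form a Morley sequence of the coheir. Non-dividing of `a'` over `b'`
provides a first coordinate with the right type over all second coordinates chosen so far, including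
the current one. -/
theorem IsCoheir.exists_seq {𝒰 : Ultrafilter (Unit → G)} {b₀ : Unit → G}
    (h : 𝔾.IsCoheir 𝒰 b₀) {a' b' : G} (hb' : 𝔾.SameTp b₀ (fun _ => b'))
    (hnd : 𝔾.NonDividing a' b') :
    ∃ c : ℕ → G × G,
      (∀ n, 𝔾.RealizesAv 𝒰 (𝔾.points ∪ {y | ∃ i < n, y = (c i).1 ∨ y = (c i).2})
        fun _ => (c n).2) ∧
      ∀ i n, i ≤ n → 𝔾.SameTp ![(c n).1, (c i).2] ![a', b'] := by
  obtain ⟨N, hN⟩ := h.exists_ball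
  obtain ⟨c, hc⟩ := exists_seq_of_forall_fin (α := G × G)
    (fun n f x => 𝔾.RealizesAv 𝒰 (𝔾.points ∪ {y | ∃ i : Fin n, y = (f i).1 ∨ y = (f i).2})
        (fun _ => x.2) ∧ (∀ i : Fin n, 𝔾.SameTp ![x.1, (f i).2] ![a', b']) ∧
        𝔾.SameTp ![x.1, x.2] ![a', b']) (by
    intro n f hf
    have hcount : {y | ∃ i : Fin n, y = (f i).1 ∨ y = (f i).2}.Countable := by
      have : {y | ∃ i : Fin n, y = (f i).1 ∨ y = (f i).2} = ⋃ i, {(f i).1, (f i).2} := by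
        ext y; simp
      rw [this]
      exact Set.countable_iUnion fun i => Set.to_countable _
    obtain ⟨y, hy⟩ := exists_realizesAv hN hcount
    let g : ℕ → Unit → G := fun i => if hi : i < n then fun _ => (f ⟨i, hi⟩).2 else y
    have hgn : g n = y := by simp [g]
    have hgi : ∀ i : Fin n, g i = fun _ => (f i).2 := fun i => by simp [g]
    obtain ⟨d, hd, hdg⟩ := exists_isMorley_extend hN Set.countable_empty (n + 1) g (by
      intro i hi
      rcases Nat.lt_succ_iff_lt_or_eq.1 hi with hi | rfl
      · have := (hf ⟨i, hi⟩).1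
        rw [hgi ⟨i, hi⟩]
        refine this.mono (Set.union_subset_union_right _ ?_)
        rintro _ (hx | ⟨j, hj, x, rfl⟩)
        · exact hx.elim
        · exact ⟨⟨j, hj⟩, Or.inr (by rw [hgi ⟨j, hj.trans hi⟩]; rfl)⟩
      · rw [hgn]
        refine hy.mono (Set.union_subset_union_right _ ?_)
        rintro _ (hx | ⟨j, hj, x, rfl⟩)
        · exact hx.elim
        · exact ⟨⟨j, hj⟩, Or.inr (by rw [hgi ⟨j, hj⟩])⟩)
    obtain ⟨x, hx⟩ := hnd d (hd.indisc (h.1.mono fun g hg i => Or.inl (hg i)))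
      fun i => (h.sameTp (hd i)).trans hb'
    refine ⟨(x, y ()), hy, fun i => ?_, ?_⟩
    · have := hx i
      rwa [hdg i (by omega), hgi] at this
    · have := hx n
      rwa [hdg n (by omega), hgn] at this)
  refine ⟨c, fun n => (hc n).1.mono (Set.union_subset_union_right _ ?_), fun i n hi => ?_⟩
  · rintro y ⟨i, hi, hy⟩
    exact ⟨⟨i, hi⟩, hy⟩
  · rcases hi.lt_or_eq with hi | rfl
    · exact (hc n).2.1 ⟨i, hi⟩
    · exact (hc i).2.2

/-- The average is unfolded first for `d t`, then for `d s`. The later term becomes the outer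
quantifier, hence the earlier index of `v`: passing from `v` to `d` reverses the order. -/
theorem IsMorley.mem_iff_hyperfilter {v d : ℕ → β → G}
    (hd : 𝔾.IsMorley ((Filter.hyperfilter ℕ).map v) (Set.range fun p : ℕ × β => v p.1 p.2) d)
    {s t : ℕ} (hst : s < t) {x y : β} {P : Set (Fin 2 → G)} (hP : 𝔾.Def P) :
    ![d t x, d s y] ∈ P ↔ ∀ᶠ n in (Filter.hyperfilter ℕ : Filter ℕ),
      ∀ᶠ m in (Filter.hyperfilter ℕ : Filter ℕ), ![v n x, v m y] ∈ P := by
  have e1 : ∀ (g : G) (z : β → G), (Sum.elim z fun _ : Unit => g) ∘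
      ![Sum.inl x, Sum.inr ()] = ![z x, g] := fun g z => by
    ext i; fin_cases i <;> rfl
  have e2 : ∀ (g : G) (z : β → G), (Sum.elim z fun _ : Unit => g) ∘
      ![Sum.inr (), Sum.inl y] = ![g, z y] := fun g z => by
    ext i; fin_cases i <;> rfl
  have h1 := (hd t).iff (hP.comp ![Sum.inl x, Sum.inr ()]) (e := fun _ : Unit => d s y)
    (fun _ => Or.inr (Or.inr ⟨s, hst, y, rfl⟩))
  have h2 := fun n => (hd s).iff (hP.comp ![Sum.inr (), Sum.inl y])
    (e := fun _ : Unit => v n x) (fun _ => Or.inr (Or.inl ⟨(n, x), rfl⟩))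
  simp only [Set.mem_ofPred_eq, e1, e2] at h1 h2
  rw [h1]
  exact Filter.eventually_congr (Filter.Eventually.of_forall h2)

/-- In the sequence of `exists_seq` one order of indices shows the type of `(a, b)` and the other
that of `(a', b')`. A Morley sequence of its nonprincipal average is indiscernible and keeps both
patterns, so no Ramsey argument is needed. -/
theorem IsCoheir.exists_indisc {𝒰 : Ultrafilter (Unit → G)} {b₀ : Unit → G}
    (h : 𝔾.IsCoheir 𝒰 b₀) {a b a' b' : G} (hb : 𝔾.RealizesAv 𝒰 (𝔾.points ∪ {a}) fun _ => b)
    (haa : 𝔾.SameTp (fun _ : Unit => a) (fun _ => a'))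
    (hbb : 𝔾.SameTp (fun _ : Unit => b) (fun _ => b')) (hnd : 𝔾.NonDividing a' b') :
    ∃ d : ℕ → Fin 2 → G, 𝔾.Indisc d ∧
      (∀ s t, s < t → 𝔾.SameTp ![d t 0, d s 1] ![a, b]) ∧
      (∀ s t, s < t → 𝔾.SameTp ![d s 0, d t 1] ![a', b']) := by
  obtain ⟨c, hc, hc'⟩ := h.exists_seq ((h.sameTp hb).symm.trans hbb) hnd
  have hc'' : ∀ i n, n < i → 𝔾.SameTp ![(c n).1, (c i).2] ![a, b] := fun i n hi =>
    h.sameTp_pair (hc i) hb (Or.inr ⟨n, hi, Or.inl rfl⟩) (Or.inr rfl)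
      ((sameTp_fst (hc' n n le_rfl)).trans haa.symm)
  let v : ℕ → Fin 2 → G := fun n => ![(c n).1, (c n).2]
  let 𝒱 : Ultrafilter (Fin 2 → G) := (Filter.hyperfilter ℕ).map v
  obtain ⟨N, hN⟩ := exists_ball_forall (𝔾 := 𝔾) ![a', b']
  have hvN : ∀ᶠ g : Fin 2 → G in 𝒱, ∀ i, g i ∈ 𝔾.ball N := by
    refine Filter.Eventually.of_forall (f := (Filter.hyperfilter ℕ : Filter ℕ)) fun n => ?_
    exact (hc' n n le_rfl _ (Def.setOf_forall fun i => def_mem_ball i N)).2 hN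
  have hC : (Set.range fun p : ℕ × Fin 2 => v p.1 p.2).Countable := Set.countable_range _
  obtain ⟨d, hd⟩ := exists_isMorley hvN hC
  have hlt : ∀ n : ℕ, ∀ᶠ m in (Filter.hyperfilter ℕ : Filter ℕ), n < m := fun n =>
    Nat.hyperfilter_le_atTop (Filter.eventually_gt_atTop n)
  refine ⟨d, hd.indisc ?_, fun s t hst P hP => ?_, fun s t hst => sameTp_swap fun P hP => ?_⟩
  · exact Filter.Eventually.of_forall (f := (Filter.hyperfilter ℕ : Filter ℕ)) fun n i =>
      Or.inr ⟨(n, i), rfl⟩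
  · rw [hd.mem_iff_hyperfilter hst hP]
    have : ∀ n, (∀ᶠ m in (Filter.hyperfilter ℕ : Filter ℕ), ![v n 0, v m 1] ∈ P) ↔ ![a, b] ∈ P := by
      intro n
      rw [← Filter.eventually_const (f := (Filter.hyperfilter ℕ : Filter ℕ)) (p := ![a, b] ∈ P)]
      exact Filter.eventually_congr ((hlt n).mono fun m hm => hc'' m n hm P hP)
    simp [this]
  · rw [hd.mem_iff_hyperfilter hst hP]
    have : ∀ n, (∀ᶠ m in (Filter.hyperfilter ℕ : Filter ℕ), ![v n 1, v m 0] ∈ P) ↔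
        ![b', a'] ∈ P := by
      intro n
      rw [← Filter.eventually_const (f := (Filter.hyperfilter ℕ : Filter ℕ)) (p := ![b', a'] ∈ P)]
      exact Filter.eventually_congr
        ((hlt n).mono fun m hm => sameTp_swap (hc' n m hm.le) P hP)
    simp [this]

end LocDefGroup

/-! ### Definable families, S1 ideals and stability of the intersection relation. -/

namespace LocDefGroup

/-- `F` is a locally definable family of subsets of the group. -/
def Fam {G : Type*} [Group G] (𝔾 : LocDefGroup G) {β : Type} (F : (β → G) → Set G) : Prop :=
  𝔾.Def {v : Unit ⊕ β → G | v (Sum.inl ()) ∈ F (v ∘ Sum.inr)}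

variable {G : Type*} [Group G] {𝔾 : LocDefGroup G} {β γ : Type} [Finite β] [Finite γ]

theorem Fam.defOver {F : (β → G) → Set G} (hF : 𝔾.Fam F) {e : β → G} {C : Set G}
    (he : ∀ j, e j ∈ C) : 𝔾.DefOver C {v : Unit → G | v () ∈ F e} :=
  Def.defOver (ι := Unit) hF e he

theorem Fam.comp {F : (β → G) → Set G} (hF : 𝔾.Fam F) (σ : β → γ) :
    𝔾.Fam fun v : γ → G => F (v ∘ σ) :=
  Def.comp hF (Sum.map id σ)

theorem Fam.inter {F F' : (β → G) → Set G} (hF : 𝔾.Fam F) (hF' : 𝔾.Fam F') :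
    𝔾.Fam fun v => F v ∩ F' v :=
  Def.inter hF hF'

theorem Fam.subset_ball {F : (β → G) → Set G} (hF : 𝔾.Fam F) {b : ℕ → β → G} (hb : 𝔾.Indisc b)
    {n : ℕ} (h : F (b 0) ⊆ 𝔾.ball n) (i : ℕ) : F (b i) ⊆ 𝔾.ball n := by
  intro x hx
  by_contra hxn
  -- A ball containing the bad point bounds the quantifier, so having a point outside `ball n`
  -- becomes a condition on the type of the parameter.
  obtain ⟨m, hm⟩ := 𝔾.exists_ball x
  have hP := 𝔾.ex m (ι := β) (κ := Unit) _
    ((Def.comp hF Sum.swap).inter (def_mem_ball (Sum.inr ()) n).compl)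
  have h1 := (hb.sameTp i 0 _ hP).1 ⟨fun _ => x, fun _ => hm, hx, hxn⟩
  obtain ⟨y, -, hy, hyn⟩ := h1
  exact hyn (h hy)

end LocDefGroup

open LocDefGroup in
/-- A translation invariant S1 ideal of definable subsets of `G`, invariant over the model. -/
structure S1Ideal {G : Type*} [Group G] (𝔾 : LocDefGroup G) where
  sets : Set (Set G)
  empty_mem : ∅ ∈ sets
  union_mem : ∀ D ∈ sets, ∀ E ∈ sets, D ∪ E ∈ sets
  mono : ∀ D ∈ sets, ∀ E : Set G, 𝔾.DefOver Set.univ {v : Unit → G | v () ∈ E} → E ⊆ D → E ∈ sets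
  inv : ∀ {β : Type} [Finite β] (F : (β → G) → Set G) (e e' : β → G), 𝔾.Fam F → 𝔾.SameTp e e' →
    F e ∈ sets → F e' ∈ sets
  s1 : ∀ {β : Type} [Finite β] (F : (β → G) → Set G) (b : ℕ → β → G), 𝔾.Fam F → 𝔾.Indisc b →
    (∃ n, ∀ i, F (b i) ⊆ 𝔾.ball n) → (∀ i j, i ≠ j → F (b i) ∩ F (b j) ∈ sets) →
    ∃ i, F (b i) ∈ sets
  mul_left : ∀ D ∈ sets, ∀ g : G, {x | g * x ∈ D} ∈ sets
  mul_right : ∀ D ∈ sets, ∀ g : G, {x | x * g ∈ D} ∈ sets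

namespace S1Ideal

open LocDefGroup

variable {G : Type*} [Group G] {𝔾 : LocDefGroup G} (μ : S1Ideal 𝔾) {β : Type}

/-- The element `a` is in no set of the ideal which is definable over the model and `C`. -/
def WideOver (C : Set G) (a : G) : Prop :=
  ∀ D ∈ μ.sets, 𝔾.DefOver C {v : Unit → G | v () ∈ D} → a ∉ D

variable {μ}

theorem WideOver.mono {C C' : Set G} {a : G} (h : μ.WideOver C a) (hC : C' ⊆ C) :
    μ.WideOver C' a := fun D hD hD' => h D hD (hD'.mono hC)

theorem WideOver.mul_left {C : Set G} {a g : G} (h : μ.WideOver C a) (hg : g ∈ C) :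
    μ.WideOver C (g * a) := fun D hD hD' hgD =>
  h _ (μ.mul_left D hD g) (hD'.subst (ι := Unit) (δ := Unit) (e := fun _ => g) (fun _ => hg)
    (f := fun _ w => w (Sum.inr ()) * w (Sum.inl ()))
    fun _ => (DFun.proj _).mul (DFun.proj _)) hgD

theorem WideOver.mul_right {C : Set G} {a g : G} (h : μ.WideOver C a) (hg : g ∈ C) :
    μ.WideOver C (a * g) := fun D hD hD' hgD =>
  h _ (μ.mul_right D hD g) (hD'.subst (ι := Unit) (δ := Unit) (e := fun _ => g) (fun _ => hg)
    (f := fun _ w => w (Sum.inl ()) * w (Sum.inr ()))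
    fun _ => (DFun.proj _).mul (DFun.proj _)) hgD

theorem WideOver.inv_mul {C : Set G} {a g : G} (h : μ.WideOver C a) (hg : g ∈ C) :
    μ.WideOver C (g⁻¹ * a) := fun D hD hD' hgD =>
  h _ (μ.mul_left D hD g⁻¹) (hD'.subst (ι := Unit) (δ := Unit) (e := fun _ => g) (fun _ => hg)
    (f := fun _ w => (w (Sum.inr ()))⁻¹ * w (Sum.inl ()))
    fun _ => (DFun.proj _).inv.mul (DFun.proj _)) hgD

theorem WideOver.mul_inv {C : Set G} {a g : G} (h : μ.WideOver C a) (hg : g ∈ C) :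
    μ.WideOver C (a * g⁻¹) := fun D hD hD' hgD =>
  h _ (μ.mul_right D hD g⁻¹) (hD'.subst (ι := Unit) (δ := Unit) (e := fun _ => g) (fun _ => hg)
    (f := fun _ w => w (Sum.inl ()) * (w (Sum.inr ()))⁻¹)
    fun _ => (DFun.proj _).mul (DFun.proj _).inv) hgD

variable (μ)

variable [Finite β]

theorem mem_iff_of_sameTp {F : (β → G) → Set G} {e e' : β → G} (hF : 𝔾.Fam F)
    (h : 𝔾.SameTp e e') : F e ∈ μ.sets ↔ F e' ∈ μ.sets :=
  ⟨μ.inv F e e' hF h, μ.inv F e' e hF h.symm⟩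

theorem exists_lt_inter_notMem {F : (β → G) → Set G} {b : ℕ → β → G} (hF : 𝔾.Fam F)
    (hb : 𝔾.Indisc b) (hbd : ∃ n, F (b 0) ⊆ 𝔾.ball n) (h : ∀ i, F (b i) ∉ μ.sets) :
    ∃ i j, i < j ∧ F (b i) ∩ F (b j) ∉ μ.sets := by
  by_contra! h'
  obtain ⟨i, hi⟩ := μ.s1 F b hF hb (hbd.imp fun n hn => hF.subset_ball hb hn) fun i j hij => by
    rcases hij.lt_or_gt with hij | hij
    · exact h' i j hij
    · rw [Set.inter_comm]
      exact h' j i hij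
  exact h i hi

/-- S1 and indiscernibility make intersections over consecutive terms wide. The pairs form an
indiscernible sequence again, so each step doubles the number of sets with a common point. -/
theorem exists_forall_lt_two_pow (k : ℕ) : ∀ {β : Type} [Finite β] (F : (β → G) → Set G)
    (b : ℕ → β → G) (n : ℕ), 𝔾.Fam F → 𝔾.Indisc b → (∀ v, F v ⊆ 𝔾.ball n) → F (b 0) ∉ μ.sets →
    ∃ x, ∀ i < 2 ^ k, x ∈ F (b i) := by
  induction k with
  | zero =>
    intro β _ F b n _ _ _ h
    have : (F (b 0)).Nonempty := by
      rw [Set.nonempty_iff_ne_empty]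
      intro h0
      exact h (h0 ▸ μ.empty_mem)
    obtain ⟨x, hx⟩ := this
    refine ⟨x, fun i hi => ?_⟩
    obtain rfl : i = 0 := by simpa using hi
    exact hx
  | succ k ih =>
    intro β _ F b n hF hb hn h
    obtain ⟨i, j, hij, h1⟩ := μ.exists_lt_inter_notMem hF hb ⟨n, hn _⟩ fun i =>
      (μ.mem_iff_of_sameTp hF (hb.sameTp 0 i)).not.1 h
    have hF2 : 𝔾.Fam fun v : β ⊕ β → G => F (v ∘ Sum.inl) ∩ F (v ∘ Sum.inr) :=
      (hF.comp Sum.inl).inter (hF.comp Sum.inr)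
    have h2 := (μ.mem_iff_of_sameTp hF2 (hb.sameTp_pair hij one_pos)).not.1 h1
    obtain ⟨x, hx⟩ := ih (fun v : Fin 2 × β → G => F (v ∘ Prod.mk 0) ∩ F (v ∘ Prod.mk 1))
      (pairs b) n ((hF.comp _).inter (hF.comp _)) hb.pairs
      (fun v => Set.inter_subset_left.trans (hn _)) h2
    refine ⟨x, fun i hi => ?_⟩
    obtain ⟨h3, h4⟩ := hx (i / 2) (by omega)
    rcases Nat.even_or_odd' i with ⟨j, rfl | rfl⟩
    · rw [Nat.mul_div_cancel_left _ two_pos] at h3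
      exact h3
    · rw [show (2 * j + 1) / 2 = j by omega] at h4
      exact h4

variable {μ}

/-- A formula of the type of `a` over `b` defines a set outside the ideal, so its conjugates along
`s` are finitely consistent by doubling. Saturation then realizes all of them together. -/
theorem WideOver.nonDividing {a b : G} (h : μ.WideOver {b} a) : 𝔾.NonDividing a b := by
  intro s hs hsb
  obtain ⟨n, hn⟩ := 𝔾.exists_ball a
  have cons_eq : ∀ (g c : Unit → G), Sum.elim g c ∘ ![Sum.inl (), Sum.inr ()] = ![g (), c ()] :=
    fun g c => by ext i; fin_cases i <;> rfl
  obtain ⟨g, -, hg⟩ := 𝔾.sat (ι := Unit) (Set.range fun i => s i ()) n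
    {Q | ∃ (P : Set (Fin 2 → G)) (i : ℕ), 𝔾.Def P ∧ ![a, b] ∈ P ∧ Q = {g | ![g (), s i ()] ∈ P}}
    (Set.countable_range _) (by
      rintro Q ⟨P, i, hP, -, rfl⟩
      have : 𝔾.DefOver (𝔾.points ∪ Set.range fun i => s i ()) _ :=
        (hP.comp ![Sum.inl (), Sum.inr ()]).defOver (s i) fun _ => Or.inr ⟨i, rfl⟩
      simp only [Set.mem_ofPred_eq, cons_eq] at this
      exact this) (by
      intro t ht hts
      choose! P i hP hab hQ using fun Q (hQ : Q ∈ t) => hts hQ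
      obtain ⟨N, hN⟩ := (ht.image i).bddAbove
      have hF : 𝔾.Fam fun v : Unit → G => {x | (∀ Q ∈ t, ![x, v ()] ∈ P Q) ∧ x ∈ 𝔾.ball n} := by
        have := (Def.setOf_forall_mem ht fun Q hQ => (hP Q hQ).comp
          ![(Sum.inl () : Unit ⊕ Unit), Sum.inr ()]).inter (def_mem_ball (Sum.inl ()) n)
        unfold Fam
        convert this using 1
        ext v
        have : v ∘ ![Sum.inl (), Sum.inr ()] = ![v (Sum.inl ()), v (Sum.inr ())] := by
          ext i; fin_cases i <;> rfl
        simp [this]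
      have hb : {x | (∀ Q ∈ t, ![x, b] ∈ P Q) ∧ x ∈ 𝔾.ball n} ∉ μ.sets := fun hmem =>
        h _ hmem (hF.defOver (e := fun _ => b) fun _ => rfl) ⟨hab, hn⟩
      obtain ⟨x, hx⟩ := μ.exists_forall_lt_two_pow (N + 1) _ s n hF hs
        (fun v x hx => hx.2) ((μ.mem_iff_of_sameTp hF (hsb 0)).not.2 hb)
      refine ⟨fun _ => x, fun _ => (hx 0 (by positivity)).2, fun Q hQt => ?_⟩
      rw [hQ Q hQt]
      exact (hx (i Q) ((Nat.lt_succ_of_le (hN ⟨Q, hQt, rfl⟩)).trans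
        (Nat.lt_two_pow_self))).1 Q hQt)
  have key : ∀ i P, 𝔾.Def P → ![a, b] ∈ P → ![g (), s i ()] ∈ P := fun i P hP hab =>
    hg _ ⟨P, i, hP, hab, rfl⟩
  refine ⟨g (), fun i P hP => ⟨fun h1 => ?_, key i P hP⟩⟩
  by_contra h2
  exact key i _ hP.compl h2 h1

variable (μ)

/-- A locally definable family of bounded sets, with a single parameter. -/
structure IsFam (𝔾 : LocDefGroup G) (φ : G → Set G) : Prop where
  fam : 𝔾.Fam fun v : Unit → G => φ (v ())
  bdd : ∀ a, ∃ n, φ a ⊆ 𝔾.ball n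

variable {φ ψ : G → Set G}

theorem inter_mem_iff (hφ : IsFam 𝔾 φ) (hψ : IsFam 𝔾 ψ) {a b a' b' : G}
    (h : 𝔾.SameTp ![a, b] ![a', b']) : φ a ∩ ψ b ∈ μ.sets ↔ φ a' ∩ ψ b' ∈ μ.sets :=
  μ.mem_iff_of_sameTp (F := fun v : Fin 2 → G => φ (v 0) ∩ ψ (v 1))
    ((hφ.fam.comp fun _ => 0).inter (hψ.fam.comp fun _ => 1)) h

/-- Group the terms in consecutive pairs: the sets `φ (d (2i+1) x) ∩ ψ (d (2i) y)` are outside the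
ideal, so two of them, for `i < j`, have intersection outside it. But that intersection lies in `φ
(d (2i+1) x) ∩ ψ (d (2j) y)`, which is in the ideal. -/
theorem not_indisc (hφ : IsFam 𝔾 φ) (hψ : IsFam 𝔾 ψ) {d : ℕ → Fin 2 → G} (hd : 𝔾.Indisc d)
    (x y : Fin 2) (h1 : ∀ s t, s < t → φ (d t x) ∩ ψ (d s y) ∉ μ.sets)
    (h2 : ∀ s t, s < t → φ (d s x) ∩ ψ (d t y) ∈ μ.sets) : False := by
  have hF : 𝔾.Fam fun v : Fin 2 × Fin 2 → G => φ (v (1, x)) ∩ ψ (v (0, y)) :=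
    (hφ.fam.comp fun _ => (1, x)).inter (hψ.fam.comp fun _ => (0, y))
  obtain ⟨i, j, hij, h⟩ := μ.exists_lt_inter_notMem hF hd.pairs
    ((hφ.bdd _).imp fun n hn => Set.inter_subset_left.trans hn)
    (fun i => h1 _ _ (by simp))
  refine h (μ.mono _ (h2 (2 * i + 1) (2 * j) (by omega)) _ ?_ fun z hz => ⟨hz.1.1, hz.2.2⟩)
  have hF2 : 𝔾.Fam fun v : (Fin 2 × Fin 2) ⊕ (Fin 2 × Fin 2) → G =>
      (φ (v (Sum.inl (1, x))) ∩ ψ (v (Sum.inl (0, y)))) ∩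
        (φ (v (Sum.inr (1, x))) ∩ ψ (v (Sum.inr (0, y)))) :=
    (hF.comp Sum.inl).inter (hF.comp Sum.inr)
  exact hF2.defOver (e := Sum.elim (pairs d i) (pairs d j)) fun _ => trivial

/-- If the two truth values differed, the sequence of `exists_indisc` would order the relation,
against `not_indisc`. -/
theorem coheir_iff (hφ : IsFam 𝔾 φ) (hψ : IsFam 𝔾 ψ) {𝒰 : Ultrafilter (Unit → G)} {b₀ : Unit → G}
    (h : 𝔾.IsCoheir 𝒰 b₀) {a b a' b' : G} (hb : 𝔾.RealizesAv 𝒰 (𝔾.points ∪ {a}) fun _ => b)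
    (haa : 𝔾.SameTp (fun _ : Unit => a) (fun _ => a'))
    (hbb : 𝔾.SameTp (fun _ : Unit => b) (fun _ => b')) (hnd : 𝔾.NonDividing a' b') :
    φ a ∩ ψ b ∈ μ.sets ↔ φ a' ∩ ψ b' ∈ μ.sets := by
  obtain ⟨d, hd, h1, h2⟩ := h.exists_indisc hb haa hbb hnd
  have h1' := fun s t hst => μ.inter_mem_iff hφ hψ (h1 s t hst)
  have h2' := fun s t hst => μ.inter_mem_iff hφ hψ (h2 s t hst)
  constructor
  · intro hm
    by_contra hm'
    refine μ.not_indisc hψ hφ hd 1 0 (fun s t hst => ?_) fun s t hst => ?_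
    · rw [Set.inter_comm, h2' s t hst]
      exact hm'
    · rw [Set.inter_comm, h1' s t hst]
      exact hm
  · intro hm'
    by_contra hm
    refine μ.not_indisc hφ hψ hd 0 1 (fun s t hst => ?_) fun s t hst => ?_
    · rw [h1' s t hst]
      exact hm
    · rw [h2' s t hst]
      exact hm'

/-- Both pairs are compared with a pair whose second member is a coheir over the first. -/
theorem inter_mem_iff_of_wide (hφ : IsFam 𝔾 φ) (hψ : IsFam 𝔾 ψ) {a b a' b' : G}
    (haa : 𝔾.SameTp (fun _ : Unit => a) (fun _ => a'))
    (hbb : 𝔾.SameTp (fun _ : Unit => b) (fun _ => b')) (h : μ.WideOver {b} a)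
    (h' : μ.WideOver {b'} a') : φ a ∩ ψ b ∈ μ.sets ↔ φ a' ∩ ψ b' ∈ μ.sets := by
  obtain ⟨𝒰, h𝒰⟩ := exists_isCoheir (𝔾 := 𝔾) fun _ : Unit => b
  obtain ⟨n, hn⟩ := h𝒰.exists_ball
  obtain ⟨c, hc⟩ := exists_realizesAv hn (Set.countable_singleton a)
  have hcb : 𝔾.SameTp c (fun _ => b) := h𝒰.sameTp hc
  rw [← μ.coheir_iff hφ hψ h𝒰 (b := c ()) hc (SameTp.refl _) hcb h.nonDividing,
    ← μ.coheir_iff hφ hψ h𝒰 (b := c ()) hc haa (hcb.trans hbb) h'.nonDividing]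

/-- Here independence points in opposite directions. The pair `(a, b)` is compared with `(a, c)`,
`c` a coheir over `a`, and `(a', b')` with `(e, c)`, `e` a coheir over `c`. Since `e` does not
divide over `c`, `coheir_iff` links `(a, c)` and `(e, c)`. -/
theorem inter_mem_iff_of_wide_of_wide (hφ : IsFam 𝔾 φ) (hψ : IsFam 𝔾 ψ) {a b a' b' : G}
    (haa : 𝔾.SameTp (fun _ : Unit => a) (fun _ => a'))
    (hbb : 𝔾.SameTp (fun _ : Unit => b) (fun _ => b')) (h : μ.WideOver {b} a)
    (h' : μ.WideOver {a'} b') : φ a ∩ ψ b ∈ μ.sets ↔ φ a' ∩ ψ b' ∈ μ.sets := by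
  obtain ⟨𝒰, h𝒰⟩ := exists_isCoheir (𝔾 := 𝔾) fun _ : Unit => b
  obtain ⟨n, hn⟩ := h𝒰.exists_ball
  obtain ⟨c, hc⟩ := exists_realizesAv hn (Set.countable_singleton a)
  have hcb : 𝔾.SameTp c (fun _ => b) := h𝒰.sameTp hc
  obtain ⟨𝒱, h𝒱⟩ := exists_isCoheir (𝔾 := 𝔾) fun _ : Unit => a
  obtain ⟨m, hm⟩ := h𝒱.exists_ball
  obtain ⟨e, he⟩ := exists_realizesAv hm (Set.countable_singleton (c ()))
  have hea : 𝔾.SameTp e (fun _ => a) := h𝒱.sameTp he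
  rw [← μ.coheir_iff hφ hψ h𝒰 (b := c ()) hc (SameTp.refl _) hcb h.nonDividing, Set.inter_comm (φ a),
    Set.inter_comm (φ a'), ← μ.coheir_iff hψ hφ h𝒱 (b := e ()) he (hcb.trans hbb) (hea.trans haa)
      h'.nonDividing, Set.inter_comm, Set.inter_comm (ψ (c ()))]
  exact μ.coheir_iff hφ hψ h𝒰 (b := c ()) hc hea.symm (SameTp.refl _) (h𝒱.nonDividing he)

end S1Ideal

/-! ### Wide types, the stabilizer and the group it generates. -/

namespace LocDefGroup

variable {G : Type*} [Group G] {𝔾 : LocDefGroup G}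

/-- `D` is a definable subset of the group: it is locally definable and bounded. -/
structure IsDef (𝔾 : LocDefGroup G) (D : Set G) : Prop where
  isDef : 𝔾.Def {v : Unit → G | v () ∈ D}
  bdd : ∃ n, D ⊆ 𝔾.ball n

theorem IsDef.inter {D E : Set G} (hD : 𝔾.IsDef D) (hE : 𝔾.IsDef E) : 𝔾.IsDef (D ∩ E) :=
  ⟨hD.isDef.inter hE.isDef, hD.bdd.imp fun _ h => Set.inter_subset_left.trans h⟩

theorem isDef_ball (n : ℕ) : 𝔾.IsDef (𝔾.ball n) := ⟨𝔾.def_ball n, n, subset_rfl⟩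

theorem IsDef.inv {D : Set G} (hD : 𝔾.IsDef D) : 𝔾.IsDef D⁻¹ :=
  ⟨(DFun.proj ()).inv.preimage hD.isDef, hD.bdd.imp fun n hn x hx => by
    simpa using 𝔾.inv_mem _ _ (hn hx)⟩

theorem IsDef.mul {D E : Set G} (hD : 𝔾.IsDef D) (hE : 𝔾.IsDef E) : 𝔾.IsDef (D * E) := by
  obtain ⟨n, hn⟩ := hD.bdd
  obtain ⟨m, hm⟩ := hE.bdd
  refine ⟨?_, n + m, ?_⟩
  · have h := 𝔾.ex n (ι := Unit) (κ := Unit) _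
      (((DFun.proj (Sum.inr ())).preimage hD.isDef).inter
        (((DFun.proj (Sum.inr ())).inv.mul (DFun.proj (Sum.inl ()))).preimage hE.isDef))
    convert h using 1
    ext v
    constructor
    · rintro ⟨x, hx, y, hy, hxy⟩
      exact ⟨fun _ => x, fun _ => hn hx, hx, by simpa [← hxy] using hy⟩
    · rintro ⟨x, -, hx, hy⟩
      exact ⟨x (), hx, _, hy, by simp⟩
  · rintro _ ⟨x, hx, y, hy, rfl⟩
    exact 𝔾.mul_mem _ _ _ _ (hn hx) (hm hy)

theorem one_mem_points : (1 : G) ∈ 𝔾.points := by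
  obtain ⟨g, hg, hg'⟩ := 𝔾.exists_point _ (def_one (𝔾 := 𝔾)) ⟨fun _ => 1, rfl⟩
  have : g () = 1 := hg
  exact this ▸ hg' ()

end LocDefGroup

namespace S1Ideal

open LocDefGroup

variable {G : Type*} [Group G] {𝔾 : LocDefGroup G} {μ : S1Ideal 𝔾} {q : Set G}

theorem isFam_mul {D : Set G} (hD : 𝔾.IsDef D) : IsFam 𝔾 fun u => {x | x * u ∈ D} := by
  refine ⟨((DFun.proj (Sum.inl ())).mul (DFun.proj (Sum.inr ()))).preimage hD.isDef, fun u => ?_⟩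
  obtain ⟨n, hn⟩ := hD.bdd
  obtain ⟨m, hm⟩ := 𝔾.exists_ball u
  refine ⟨n + m, fun x hx => ?_⟩
  simpa using 𝔾.mul_mem _ _ _ _ (hn hx) (𝔾.inv_mem _ _ hm)

theorem isFam_mul_inv {D : Set G} (hD : 𝔾.IsDef D) : IsFam 𝔾 fun u => {x | x * u⁻¹ ∈ D} :=
  ⟨((DFun.proj (Sum.inl ())).mul (DFun.proj (Sum.inr ())).inv).preimage hD.isDef,
    fun u => (isFam_mul hD).bdd u⁻¹⟩

variable (μ)

/-- `q` is the set of realizations of a wide complete type over the model. -/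
structure IsWideType (q : Set G) : Prop where
  sameTp : ∀ a ∈ q, ∀ b ∈ q, 𝔾.SameTp (fun _ : Unit => a) (fun _ => b)
  mem : ∀ a ∈ q, ∀ b, 𝔾.SameTp (fun _ : Unit => a) (fun _ => b) → b ∈ q
  wide : ∀ D ∈ μ.sets, ¬ q ⊆ D

/-- The definable sets containing `q`. -/
def defNhds (𝔾 : LocDefGroup G) (q : Set G) : Set (Set G) := {D | 𝔾.IsDef D ∧ q ⊆ D}

/-- The set of `g` such that `q ∩ q g` is wide. -/
def stab (q : Set G) : Set G := {g | ∀ D ∈ defNhds 𝔾 q, D ∩ {x | x * g ∈ D} ∉ μ.sets}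

theorem nonempty_of_notMem {D : Set G} (hD : D ∉ μ.sets) : D.Nonempty := by
  rw [Set.nonempty_iff_ne_empty]
  rintro rfl
  exact hD μ.empty_mem

theorem mem_mul_right_iff {D : Set G} (g : G) : {x | x * g ∈ D} ∈ μ.sets ↔ D ∈ μ.sets := by
  refine ⟨fun h => ?_, fun h => μ.mul_right D h g⟩
  simpa using μ.mul_right _ h g⁻¹

theorem mem_mul_left_iff {D : Set G} (g : G) : {x | g * x ∈ D} ∈ μ.sets ↔ D ∈ μ.sets := by
  refine ⟨fun h => ?_, fun h => μ.mul_left D h g⟩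
  simpa using μ.mul_left _ h g⁻¹

/-- Right translation by `u` turns membership of a quotient in the stabilizer into the two-variable
relation to which stability applies. -/
theorem inv_mul_mem_stab_iff {u v : G} : u⁻¹ * v ∈ μ.stab q ↔
    ∀ D ∈ defNhds 𝔾 q, {x | x * u ∈ D} ∩ {x | x * v ∈ D} ∉ μ.sets := by
  refine forall₂_congr fun D _ => not_congr ?_
  rw [← μ.mem_mul_right_iff u]
  refine iff_of_eq (congrArg (· ∈ μ.sets) ?_)
  ext x
  simp [mul_assoc]

theorem mul_mem_stab_iff {u v : G} : u * v ∈ μ.stab q ↔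
    ∀ D ∈ defNhds 𝔾 q, {x | x * u⁻¹ ∈ D} ∩ {x | x * v ∈ D} ∉ μ.sets := by
  rw [← μ.inv_mul_mem_stab_iff, inv_inv]

variable {μ}

theorem inv_mem_stab {g : G} (h : g ∈ μ.stab q) : g⁻¹ ∈ μ.stab q := by
  rw [← mul_one g⁻¹, inv_mul_mem_stab_iff]
  intro D hD
  rw [Set.inter_comm]
  simpa using h D hD

/-- If the type of `a` were inconsistent with avoiding the sets of the ideal over `C`, finitely many
of these sets would cover a set definable over the model and containing `a`, which would then be in
the ideal. -/
theorem exists_wideOver {a : G} (ha : μ.WideOver ∅ a) {C : Set G} (hC : C.Countable) :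
    ∃ a', 𝔾.SameTp (fun _ : Unit => a) (fun _ => a') ∧ μ.WideOver C a' := by
  obtain ⟨n, hn⟩ := 𝔾.exists_ball a
  obtain ⟨g, -, hg⟩ := 𝔾.sat (ι := Unit) C n
    {Q | (∃ D ∈ μ.sets, 𝔾.DefOver C {v : Unit → G | v () ∈ D} ∧ Q = {v | v () ∉ D}) ∨
      (𝔾.Def Q ∧ (fun _ => a) ∈ Q)} hC (by
    rintro Q (⟨D, -, ⟨m, P, e, hP, he, hQ⟩, rfl⟩ | ⟨hQ, -⟩)
    · refine ⟨m, Pᶜ, e, hP.compl, fun j => Or.inr (he j), ?_⟩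
      ext v
      exact not_congr (Set.ext_iff.1 hQ v)
    · exact hQ.defOver_self _) (by
    intro t ht hts
    have : ∃ D ∈ μ.sets, ∃ P : Set (Unit → G), 𝔾.Def P ∧ (fun _ => a) ∈ P ∧
        ∀ g ∈ P, g () ∉ D → ∀ Q ∈ t, g ∈ Q := by
      induction t, ht using Set.Finite.induction_on with
      | empty => exact ⟨∅, μ.empty_mem, _, 𝔾.univ, trivial, by simp⟩
      | @insert Q t _ _ ih =>
        obtain ⟨D, hD, P, hP, haP, h⟩ := ih ((Set.subset_insert _ _).trans hts)
        rcases hts (Set.mem_insert _ _) with ⟨E, hE, -, rfl⟩ | ⟨hQ, haQ⟩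
        · refine ⟨D ∪ E, μ.union_mem _ hD _ hE, P, hP, haP, fun g hg hgD => ?_⟩
          rintro _ (rfl | hR)
          · exact fun h' => hgD (Or.inr h')
          · exact h g hg (fun h' => hgD (Or.inl h')) _ hR
        · refine ⟨D, hD, P ∩ Q, hP.inter hQ, ⟨haP, haQ⟩, fun g hg hgD => ?_⟩
          rintro _ (rfl | hR)
          · exact hg.2
          · exact h g hg.1 hgD _ hR
    obtain ⟨D, hD, P, hP, haP, h⟩ := this
    have hP' : 𝔾.Def {v : Unit → G | v () ∈ {x | (fun _ => x) ∈ P ∧ x ∈ 𝔾.ball n}} :=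
      hP.inter (𝔾.def_ball n)
    by_contra! hcon
    refine ha _ (μ.mono D hD _ (hP'.defOver_self _) fun x hx => ?_) (hP'.defOver_self _) ⟨haP, hn⟩
    by_contra hxD
    obtain ⟨Q, hQ, hgQ⟩ := hcon (fun _ => x) fun _ => hx.2
    exact hgQ (h _ hx.1 hxD Q hQ))
  have key : ∀ P : Set (Unit → G), 𝔾.Def P → (fun _ => a) ∈ P → g ∈ P := fun P hP haP =>
    hg P (Or.inr ⟨hP, haP⟩)
  refine ⟨g (), fun P hP => ⟨key P hP, fun h => ?_⟩, fun D hD hDC => hg _ (Or.inl ⟨D, hD, hDC, rfl⟩)⟩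
  by_contra h'
  exact key _ hP.compl h' h

theorem isDef_sq {D : Set G} (hD : D ∈ defNhds 𝔾 q) : 𝔾.IsDef ((D⁻¹ * D) ^ 2) := by
  rw [pow_two]
  exact (hD.1.inv.mul hD.1).mul (hD.1.inv.mul hD.1)

namespace IsWideType

variable (hq : μ.IsWideType q)
include hq

theorem nonempty : q.Nonempty := by
  rw [Set.nonempty_iff_ne_empty]
  rintro rfl
  exact hq.wide ∅ μ.empty_mem subset_rfl

theorem subset_of_mem {D : Set G} (hD : 𝔾.Def {v : Unit → G | v () ∈ D}) {a : G} (ha : a ∈ q)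
    (haD : a ∈ D) : q ⊆ D := fun b hb => (hq.sameTp a ha b hb _ hD).1 haD

theorem exists_ball : ∃ n, 𝔾.ball n ∈ defNhds 𝔾 q := by
  obtain ⟨a, ha⟩ := hq.nonempty
  exact (𝔾.exists_ball a).imp fun n hn =>
    ⟨isDef_ball n, hq.subset_of_mem (𝔾.def_ball n) ha hn⟩

theorem notMem {D : Set G} (hD : D ∈ defNhds 𝔾 q) : D ∉ μ.sets := fun h => hq.wide D h hD.2

theorem wideOver_empty {a : G} (ha : a ∈ q) : μ.WideOver ∅ a := fun D hD hD' haD =>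
  hq.wide D hD (hq.subset_of_mem (DefOver.def_of_empty hD') ha haD)

theorem exists_wideOver {C : Set G} (hC : C.Countable) : ∃ b ∈ q, μ.WideOver C b := by
  obtain ⟨a, ha⟩ := hq.nonempty
  obtain ⟨b, hb, hb'⟩ := S1Ideal.exists_wideOver (hq.wideOver_empty ha) hC
  exact ⟨b, hq.mem a ha b hb, hb'⟩

theorem mem_of_forall {x : G} (hx : ∀ D ∈ defNhds 𝔾 q, x ∈ D) : x ∈ q := by
  obtain ⟨a, ha⟩ := hq.nonempty
  obtain ⟨n, hn⟩ := hq.exists_ball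
  have key : ∀ P : Set (Unit → G), 𝔾.Def P → (fun _ => a) ∈ P → (fun _ => x) ∈ P := by
    intro P hP haP
    have hP' : 𝔾.Def {v : Unit → G | v () ∈ {x | (fun _ => x) ∈ P ∧ x ∈ 𝔾.ball n}} :=
      hP.inter (𝔾.def_ball n)
    exact (hx _ ⟨⟨hP', n, fun y hy => hy.2⟩, hq.subset_of_mem hP' ha ⟨haP, hn.2 ha⟩⟩).1
  refine hq.mem a ha x fun P hP => ⟨key P hP, fun h => ?_⟩
  by_contra h'
  exact key _ hP.compl h' h

/-- Compactness along the definable sets containing `q`, which are closed under intersection: it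
suffices to satisfy the monotone condition `R D` for one `D` at a time. -/
theorem exists_forall_mem {ι : Type} [Finite ι] {C : Set G} (hC : C.Countable) (n : ℕ)
    (R : Set G → Set (ι → G)) (hmono : ∀ D E, D ⊆ E → R D ⊆ R E)
    (hR : ∀ D ∈ defNhds 𝔾 q, 𝔾.DefOver (𝔾.points ∪ C) (R D))
    (h : ∀ D ∈ defNhds 𝔾 q, ∃ g ∈ R D, ∀ i, g i ∈ 𝔾.ball n) :
    ∃ g, ∀ D ∈ defNhds 𝔾 q, g ∈ R D := by
  obtain ⟨g, -, hg⟩ := 𝔾.sat C n (R '' defNhds 𝔾 q) hC (by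
    rintro _ ⟨D, hD, rfl⟩
    exact hR D hD) (by
    intro t ht hts
    have : ∃ D ∈ defNhds 𝔾 q, ∀ Q ∈ t, R D ⊆ Q := by
      induction t, ht using Set.Finite.induction_on with
      | empty =>
        obtain ⟨n, hn⟩ := hq.exists_ball
        exact ⟨_, hn, by simp⟩
      | @insert Q t _ _ ih =>
        obtain ⟨D, hD, h1⟩ := ih ((Set.subset_insert _ _).trans hts)
        obtain ⟨E, hE, rfl⟩ := hts (Set.mem_insert _ _)
        refine ⟨D ∩ E, ⟨hD.1.inter hE.1, Set.subset_inter hD.2 hE.2⟩, ?_⟩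
        rintro _ (rfl | hR)
        · exact hmono _ _ Set.inter_subset_right
        · exact (hmono _ _ Set.inter_subset_left).trans (h1 _ hR)
    obtain ⟨D, hD, h1⟩ := this
    obtain ⟨g, hg, hgn⟩ := h D hD
    exact ⟨g, hgn, fun Q hQ => h1 Q hQ hg⟩)
  exact ⟨g, fun D hD => hg _ ⟨D, hD, rfl⟩⟩

theorem stab_subset : μ.stab q ⊆ q⁻¹ * q := by
  intro g hg
  obtain ⟨n, hn⟩ := hq.exists_ball
  obtain ⟨y, hy⟩ := hq.exists_forall_mem (ι := Unit) (Set.countable_singleton g) n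
    (fun D => {y | y () ∈ D ∧ y () * g ∈ D}) (fun D E hDE y hy => ⟨hDE hy.1, hDE hy.2⟩)
    (fun D hD => (((DFun.proj (Sum.inl ())).preimage hD.1.isDef).inter
      (((DFun.proj (Sum.inl ())).mul (DFun.proj (Sum.inr ()))).preimage hD.1.isDef)).defOver
      (fun _ : Unit => g) fun _ => Or.inr rfl)
    (fun D hD => by
      have := hg (D ∩ 𝔾.ball n) ⟨hD.1.inter hn.1, Set.subset_inter hD.2 hn.2⟩
      obtain ⟨y, hy⟩ := μ.nonempty_of_notMem this
      exact ⟨fun _ => y, ⟨hy.1.1, hy.2.1⟩, fun _ => hy.1.2⟩)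
  refine ⟨(y ())⁻¹, ?_, y () * g, hq.mem_of_forall fun D hD => (hy D hD).2, by simp⟩
  simpa using hq.mem_of_forall fun D hD => (hy D hD).1

/-- On a Morley sequence of a coheir of `a`, S1 gives two terms whose translates of `D` have
intersection outside the ideal. Stability carries this to `(b, a)`, since `b` does not divide over
`a`. -/
theorem inv_mul_mem_stab {a b : G} (ha : a ∈ q) (hb : b ∈ q) (h : μ.WideOver {a} b) :
    a⁻¹ * b ∈ μ.stab q := by
  rw [inv_mul_mem_stab_iff]
  intro D hD
  have hF := isFam_mul hD.1
  obtain ⟨𝒰, h𝒰⟩ := exists_isCoheir (𝔾 := 𝔾) fun _ : Unit => a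
  obtain ⟨n, hn⟩ := h𝒰.exists_ball
  obtain ⟨d, hd⟩ := exists_isMorley hn Set.countable_empty
  obtain ⟨i, j, hij, h1⟩ := μ.exists_lt_inter_notMem hF.fam
    (hd.indisc (h𝒰.1.mono fun g hg i => Or.inl (hg i))) (hF.bdd _) fun i => by
      rw [mem_mul_right_iff]
      exact hq.notMem hD
  have hdj := (hd j).mono (C' := 𝔾.points ∪ {d i ()}) (Set.union_subset_union_right _ (by
    rintro _ rfl
    exact Or.inr ⟨i, hij, (), rfl⟩))
  have hda : ∀ i, 𝔾.SameTp (d i) fun _ => a := fun i => h𝒰.sameTp (hd i)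
  rw [Set.inter_comm]
  exact (μ.coheir_iff hF hF h𝒰 (b := d j ()) hdj ((hda i).trans (hq.sameTp a ha b hb)) (hda j)
    h.nonDividing).not.1 h1

/-- The element `h * a⁻¹` is wide over `a` and over `c`, which have the same type, so stability
allows `a` to be replaced by `c` in `h = (h * a⁻¹) * a`. -/
theorem mul_inv_mul_mem_stab {h a c : G} (ha : a ∈ q) (hc : c ∈ q) (hh : h ∈ μ.stab q)
    (hw : μ.WideOver {a, c} h) : h * a⁻¹ * c ∈ μ.stab q := by
  have hd : μ.WideOver {a, c} (h * a⁻¹) := hw.mul_inv (by simp)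
  have h1 : h * a⁻¹ * a ∈ μ.stab q := by simpa using hh
  rw [mul_mem_stab_iff] at h1 ⊢
  exact fun D hD => (μ.inter_mem_iff_of_wide (isFam_mul_inv hD.1) (isFam_mul hD.1) (SameTp.refl _)
    (hq.sameTp a ha c hc) (hd.mono (by simp)) (hd.mono (by simp))).not.1 (h1 D hD)

/-- The same exchange on the other side, with `a * v` wide over both `a` and `b`. -/
theorem inv_mul_mul_mem_stab {v a b : G} (ha : a ∈ q) (hb : b ∈ q) (hv : v ∈ μ.stab q)
    (hw : μ.WideOver {a, b} v) : b⁻¹ * (a * v) ∈ μ.stab q := by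
  have hd : μ.WideOver {a, b} (a * v) := hw.mul_left (by simp)
  have h1 : (a * v)⁻¹ * a ∈ μ.stab q := by simpa using inv_mem_stab hv
  have h2 : (a * v)⁻¹ * b ∈ μ.stab q := by
    rw [inv_mul_mem_stab_iff] at h1 ⊢
    exact fun D hD => (μ.inter_mem_iff_of_wide (isFam_mul hD.1) (isFam_mul hD.1) (SameTp.refl _)
      (hq.sameTp a ha b hb) (hd.mono (by simp)) (hd.mono (by simp))).not.1 (h1 D hD)
  simpa [mul_assoc] using inv_mem_stab h2

theorem exists_stab_wideOver {a : G} (ha : a ∈ q) {C : Set G} (hC : C.Countable) :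
    ∃ b ∈ q, a⁻¹ * b ∈ μ.stab q ∧ μ.WideOver C (a⁻¹ * b) := by
  obtain ⟨b, hb, hb'⟩ := hq.exists_wideOver (hC.insert a)
  exact ⟨b, hb, hq.inv_mul_mem_stab ha hb (hb'.mono (by simp)),
    (hb'.inv_mul (Set.mem_insert _ _)).mono (Set.subset_insert _ _)⟩

theorem exists_mul_mem_stab (n : ℕ) : ∀ g ∈ (q⁻¹ * q) ^ n, ∃ C : Set G, C.Finite ∧
    ∀ h ∈ μ.stab q, μ.WideOver C h → h * g ∈ μ.stab q := by
  induction n with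
  | zero =>
    intro g hg
    obtain rfl : g = 1 := by simpa using hg
    exact ⟨∅, Set.finite_empty, fun h hh _ => by simpa using hh⟩
  | succ n ih =>
    rw [pow_succ]
    rintro _ ⟨g, hg, _, ⟨a, ha, c, hc, rfl⟩, rfl⟩
    obtain ⟨C, hC, h1⟩ := ih g hg
    refine ⟨C ∪ {g, a⁻¹, c}, hC.union (Set.toFinite _), fun h hh hw => ?_⟩
    have h2 := h1 h hh (hw.mono Set.subset_union_left)
    have h3 : μ.WideOver {g, a⁻¹, c} (h * g) :=
      (hw.mono Set.subset_union_right).mul_right (by simp)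
    have h4 := hq.mul_inv_mul_mem_stab ha hc h2 (h3.mono (by simp))
    simpa [mul_assoc] using h4

/-- For generic `h` in the stabilizer both `h⁻¹` and `h * g` are in it, hence in `q⁻¹ * q`, and `g`
is their product. -/
theorem pow_subset (n : ℕ) : (q⁻¹ * q) ^ n ⊆ (q⁻¹ * q) ^ 2 := by
  intro g hg
  obtain ⟨a, ha⟩ := hq.nonempty
  obtain ⟨C, hC, h⟩ := hq.exists_mul_mem_stab n g hg
  obtain ⟨b, -, hb, hb'⟩ := hq.exists_stab_wideOver ha hC.countable
  rw [pow_two]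
  exact ⟨_, hq.stab_subset (inv_mem_stab hb), _, hq.stab_subset (h _ hb hb'), by simp [mul_assoc]⟩

/-- The group generated by `q⁻¹ q`. -/
def subgroup : Subgroup G where
  carrier := (q⁻¹ * q) ^ 2
  mul_mem' {a b} ha hb := hq.pow_subset 4 (by
    rw [show 4 = 2 + 2 from rfl, pow_add]
    exact Set.mul_mem_mul ha hb)
  one_mem' := hq.pow_subset 0 (by simp)
  inv_mem' {a} ha := by
    have : ((q⁻¹ * q) ^ 2)⁻¹ = (q⁻¹ * q) ^ 2 := by
      rw [← inv_pow, mul_inv_rev, inv_inv]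
    rw [← this]
    simpa using ha

theorem mem_subgroup {x : G} : x ∈ hq.subgroup ↔ x ∈ (q⁻¹ * q) ^ 2 := Iff.rfl

theorem inv_mul_mem_subgroup {a b : G} (ha : a ∈ q) (hb : b ∈ q) : a⁻¹ * b ∈ hq.subgroup :=
  hq.pow_subset 1 (by
    rw [pow_one]
    exact Set.mul_mem_mul (by simpa using ha) hb)

/-- For a generic `h = a⁻¹ * b` in the stabilizer, `h * g` is in it. Symmetric stability moves this
from `g`, over which `h` is wide, to a `g'` of the same type that is wide over `h`, `a`, `b`.
Multiplying by `b⁻¹ * a` cancels `h`, so `g'`, and by invariance `g`, is in the stabilizer. -/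
theorem mem_stab_of_wide {g : G} (hg : g ∈ hq.subgroup) (hw : μ.WideOver ∅ g) : g ∈ μ.stab q := by
  obtain ⟨a, ha⟩ := hq.nonempty
  obtain ⟨C, hC, h⟩ := hq.exists_mul_mem_stab 2 g hg
  obtain ⟨b, hb, hs, hb'⟩ := hq.exists_stab_wideOver ha (hC.countable.insert g)
  have h1 := h _ hs (hb'.mono (Set.subset_insert _ _))
  obtain ⟨g', hgg', hg'⟩ := S1Ideal.exists_wideOver hw
    (Set.to_countable {a⁻¹ * b, a, b})
  have h2 : a⁻¹ * b * g' ∈ μ.stab q := by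
    rw [mul_mem_stab_iff] at h1 ⊢
    exact fun D hD => (μ.inter_mem_iff_of_wide_of_wide (isFam_mul_inv hD.1) (isFam_mul hD.1)
      (SameTp.refl _) hgg' (hb'.mono (by simp)) (hg'.mono (by simp))).not.1 (h1 D hD)
  have h3 := hq.inv_mul_mul_mem_stab ha hb h2 ((hg'.mul_left (by simp)).mono (by simp))
  rw [show b⁻¹ * (a * (a⁻¹ * b * g')) = g' by group] at h3
  intro D hD
  have hF : 𝔾.Fam fun v : Unit → G => D ∩ {x | x * v () ∈ D} :=
    ((DFun.proj (Sum.inl ())).preimage hD.1.isDef).inter (isFam_mul hD.1).fam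
  exact (μ.mem_iff_of_sameTp hF hgg').not.2 (h3 D hD)

/-- For `x` in the coset `a • S`, take `b ∈ q` wide over `x`. Then `x⁻¹ * b` is a wide element of
`S`, hence in the stabilizer, so `x = b * (b⁻¹ * x)` lies in `q * (q⁻¹ * q)`. -/
theorem exists_mul_inv_mul_eq : ∃ g : G, q * q⁻¹ * q = g • (hq.subgroup : Set G) := by
  obtain ⟨a, ha⟩ := hq.nonempty
  refine ⟨a, Set.Subset.antisymm ?_ fun x hx => ?_⟩
  · rintro _ ⟨_, ⟨b, hb, c, hc, rfl⟩, d, hd, rfl⟩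
    rw [Set.mem_smul_set_iff_inv_smul_mem]
    have := hq.subgroup.mul_mem (hq.inv_mul_mem_subgroup ha hb)
      (hq.inv_mul_mem_subgroup hc hd)
    simpa [mul_assoc] using this
  · rw [Set.mem_smul_set_iff_inv_smul_mem] at hx
    obtain ⟨b, hb, hw⟩ := hq.exists_wideOver (Set.countable_singleton x)
    have h1 : x⁻¹ * b ∈ hq.subgroup := by
      have := hq.subgroup.mul_mem (hq.subgroup.inv_mem hx) (hq.inv_mul_mem_subgroup ha hb)
      simpa [mul_assoc] using this
    have h2 := hq.mem_stab_of_wide h1 ((hw.inv_mul rfl).mono (Set.empty_subset _))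
    have h3 := hq.stab_subset (inv_mem_stab h2)
    rw [mul_assoc]
    exact ⟨b, hb, _, h3, by simp⟩

/-- For the converse, saturation finds four elements of `q` whose alternating product is `x`, from
such quadruples in each `D`. -/
theorem mem_subgroup_iff {x : G} :
    x ∈ hq.subgroup ↔ ∀ D ∈ defNhds 𝔾 q, x ∈ (D⁻¹ * D) ^ 2 := by
  constructor
  · exact fun hx D hD => Set.pow_subset_pow_left
      (Set.mul_subset_mul (Set.inv_subset_inv.2 hD.2) hD.2) hx
  · intro hx
    obtain ⟨n, hn⟩ := hq.exists_ball
    obtain ⟨y, hy⟩ := hq.exists_forall_mem (ι := Fin 4) (Set.countable_singleton x) n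
      (fun D => {y | (∀ i, y i ∈ D) ∧ (y 0)⁻¹ * y 1 * ((y 2)⁻¹ * y 3) * x⁻¹ ∈ ({1} : Set G)})
      (fun D E hDE y hy => ⟨fun i => hDE (hy.1 i), hy.2⟩)
      (fun D hD => ((Def.setOf_forall fun i : Fin 4 =>
          (DFun.proj (Sum.inl i)).preimage hD.1.isDef).inter
        (((((DFun.proj (Sum.inl 0)).inv.mul (DFun.proj (Sum.inl 1))).mul
          ((DFun.proj (Sum.inl 2)).inv.mul (DFun.proj (Sum.inl 3)))).mul
          (DFun.proj (Sum.inr ())).inv).preimage def_one)).defOver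
        (fun _ : Unit => x) fun _ => Or.inr rfl)
      (fun D hD => by
        have := hx (D ∩ 𝔾.ball n) ⟨hD.1.inter hn.1, Set.subset_inter hD.2 hn.2⟩
        rw [pow_two] at this
        obtain ⟨_, ⟨a, ha, b, hb, rfl⟩, _, ⟨c, hc, d, hd, rfl⟩, rfl⟩ := this
        refine ⟨![a⁻¹, b, c⁻¹, d], ⟨fun i => ?_, by simp [mul_assoc]⟩, fun i => ?_⟩
        · fin_cases i
          exacts [ha.1, hb.1, hc.1, hd.1]
        · fin_cases i
          exacts [ha.2, hb.2, hc.2, hd.2])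
    have hyq : ∀ i, y i ∈ q := fun i => hq.mem_of_forall fun D hD => (hy D hD).1 i
    have hyx := (hy _ hn).2
    rw [Set.mem_singleton_iff, mul_inv_eq_one] at hyx
    rw [← hyx]
    exact mul_mem (hq.inv_mul_mem_subgroup (hyq 0) (hyq 1))
      (hq.inv_mul_mem_subgroup (hyq 2) (hyq 3))

/-- For `a ∈ q` the set `D⁻¹ * D` contains the translate `a⁻¹ D`. -/
theorem inv_mul_notMem {D : Set G} (hD : D ∈ defNhds 𝔾 q) : D⁻¹ * D ∉ μ.sets := by
  obtain ⟨a, ha⟩ := hq.nonempty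
  intro h
  refine hq.notMem hD ((μ.mem_mul_left_iff a).1 ?_)
  refine μ.mono _ h _ ?_ fun x hx => ⟨a⁻¹, by simpa using hD.2 ha, a * x, hx, by simp⟩
  exact (((DFun.proj (Sum.inr ())).mul (DFun.proj (Sum.inl ()))).preimage hD.1.isDef).defOver
    (ι := Unit) (fun _ : Unit => a) fun _ => trivial

/-- The translates `b i * m * (D⁻¹ * D)` are outside the ideal, so by S1 two of them meet; a common
point gives the required quotient. -/
theorem exists_lt_mem {D : Set G} (hD : D ∈ defNhds 𝔾 q) {b : ℕ → Unit → G} (hb : 𝔾.Indisc b)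
    {m : G} (hm : m ∈ 𝔾.points) :
    ∃ i j, i < j ∧ m⁻¹ * ((b i ())⁻¹ * b j ()) * m ∈ (D⁻¹ * D) ^ 2 := by
  have hW := hD.1.inv.mul hD.1
  have hF : 𝔾.Fam fun v : Unit → G => {x | m⁻¹ * ((v ())⁻¹ * x) ∈ D⁻¹ * D} :=
    𝔾.fiber_point (ι := Unit ⊕ Unit) (κ := Unit) _ (fun _ => m)
      (((DFun.proj (Sum.inr ())).inv.mul ((DFun.proj (Sum.inl (Sum.inr ()))).inv.mul
        (DFun.proj (Sum.inl (Sum.inl ()))))).preimage hW.isDef) fun _ => hm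
  obtain ⟨i, j, hij, h⟩ := μ.exists_lt_inter_notMem hF hb (by
      obtain ⟨n, hn⟩ := hW.bdd
      obtain ⟨k, hk⟩ := 𝔾.exists_ball (b 0 () * m)
      refine ⟨k + n, fun x hx => ?_⟩
      simpa [mul_assoc] using 𝔾.mul_mem _ _ _ _ hk (hn hx)) fun i hi => by
    refine hq.inv_mul_notMem hD ((μ.mem_mul_left_iff (m⁻¹ * (b i ())⁻¹)).1 ?_)
    simpa [mul_assoc] using hi
  obtain ⟨x, hx, hx'⟩ := μ.nonempty_of_notMem h
  refine ⟨i, j, hij, ?_⟩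
  rw [pow_two]
  refine ⟨_, hx, (m⁻¹ * ((b j ())⁻¹ * x))⁻¹, ?_, by group⟩
  have : (D⁻¹ * D)⁻¹ = D⁻¹ * D := by rw [mul_inv_rev, inv_inv]
  exact this ▸ Set.inv_mem_inv.2 hx'

/-- In a Morley sequence of a coheir of `g`, some quotient of two terms lies in the symmetric set
`(D⁻¹ * D) ^ 2`. The later term can be replaced by a model point, and the earlier one has the type
of `g`. -/
theorem exists_point_mul_mem {D : Set G} (hD : D ∈ defNhds 𝔾 q) (g : G) :
    ∃ m ∈ 𝔾.points, m⁻¹ * g ∈ (D⁻¹ * D) ^ 2 := by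
  obtain ⟨𝒰, h𝒰⟩ := exists_isCoheir (𝔾 := 𝔾) fun _ : Unit => g
  obtain ⟨n, hn⟩ := h𝒰.exists_ball
  obtain ⟨d, hd⟩ := exists_isMorley hn Set.countable_empty
  obtain ⟨i, j, hij, h⟩ := hq.exists_lt_mem hD
    (hd.indisc (h𝒰.1.mono fun g hg i => Or.inl (hg i))) one_mem_points
  simp only [inv_one, one_mul, mul_one] at h
  have hE := (isDef_sq hD).isDef
  have h1 := ((hd j).iff (β := Unit) (((DFun.proj (Sum.inr ())).inv.mul
    (DFun.proj (Sum.inl ()))).preimage hE) (e := d i)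
    fun x => Or.inr (Or.inr ⟨i, hij, x, rfl⟩)).1 h
  obtain ⟨m, hm, hmp⟩ := (h1.and h𝒰.1).exists
  refine ⟨m (), hmp (), ?_⟩
  have h2 : (m ())⁻¹ * d i () ∈ (D⁻¹ * D) ^ 2 := by
    have : ((D⁻¹ * D) ^ 2)⁻¹ = (D⁻¹ * D) ^ 2 := by rw [← inv_pow, mul_inv_rev, inv_inv]
    rw [← this]
    simpa using hm
  exact ((h𝒰.sameTp (hd i)) _ (𝔾.fiber_point (ι := Unit) (κ := Unit) _ m
    (((DFun.proj (Sum.inr ())).inv.mul (DFun.proj (Sum.inl ()))).preimage hE) hmp)).1 h2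

theorem conj_mem_of_coheir {𝒰 : Ultrafilter (Unit → G)} {b₀ : Unit → G}
    (h𝒰 : 𝔾.IsCoheir 𝒰 b₀) {a c : G} (hab : 𝔾.SameTp b₀ fun _ => a)
    (hc : 𝔾.RealizesAv 𝒰 (𝔾.points ∪ {a}) fun _ => c) (g : G) :
    g⁻¹ * (a⁻¹ * c) * g ∈ hq.subgroup := by
  obtain ⟨n, hn⟩ := h𝒰.exists_ball
  obtain ⟨d, hd⟩ := exists_isMorley hn Set.countable_empty
  have key : ∀ D ∈ defNhds 𝔾 q, ∀ m ∈ 𝔾.points, m⁻¹ * (a⁻¹ * c) * m ∈ (D⁻¹ * D) ^ 2 := by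
    intro D hD m hm
    obtain ⟨i, j, hij, h⟩ := hq.exists_lt_mem hD
      (hd.indisc (h𝒰.1.mono fun g hg i => Or.inl (hg i))) hm
    have h1 : 𝔾.SameTp ![d i (), d j ()] ![a, c] :=
      h𝒰.sameTp_pair (hd j) hc (Or.inr (Or.inr ⟨i, hij, (), rfl⟩)) (Or.inr rfl)
        ((h𝒰.sameTp (hd i)).trans hab)
    exact (h1 _ (𝔾.fiber_point (ι := Fin 2) (κ := Unit) _ (fun _ => m)
      ((((DFun.proj (Sum.inr ())).inv.mul ((DFun.proj (Sum.inl 0)).inv.mul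
        (DFun.proj (Sum.inl 1)))).mul (DFun.proj (Sum.inr ()))).preimage
        (isDef_sq hD).isDef) fun _ => hm)).1 h
  obtain ⟨k, hk⟩ := 𝔾.exists_ball g
  obtain ⟨l, hl⟩ := hq.exists_ball
  obtain ⟨N, hN⟩ := (isDef_sq hl).bdd
  -- Each `D` is served by a point of the model; compactness gives one `m` for all `D`, no longer in
  -- the model. The bound `k + N` comes from `m = g * (m⁻¹ * g)⁻¹`. Conjugation by `g` is then
  -- conjugation by `m` followed by conjugation by an element of the group.
  obtain ⟨m, hm⟩ := hq.exists_forall_mem (ι := Unit) (Set.to_countable {g, a⁻¹ * c}) (k + N)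
    (fun D => {m | (m ())⁻¹ * g ∈ (D⁻¹ * D) ^ 2 ∧
      (m ())⁻¹ * (a⁻¹ * c) * m () ∈ (D⁻¹ * D) ^ 2})
    (fun D E hDE y hy => by
      have := Set.pow_subset_pow_left (n := 2)
        (Set.mul_subset_mul (Set.inv_subset_inv.2 hDE) hDE)
      exact ⟨this hy.1, this hy.2⟩)
    (fun D hD => ((((DFun.proj (Sum.inl ())).inv.mul (DFun.proj (Sum.inr 0))).preimage
        (isDef_sq hD).isDef).inter
      ((((DFun.proj (Sum.inl ())).inv.mul (DFun.proj (Sum.inr 1))).mul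
        (DFun.proj (Sum.inl ()))).preimage (isDef_sq hD).isDef)).defOver ![g, a⁻¹ * c]
        (by intro j; fin_cases j <;> simp))
    (fun D hD => by
      obtain ⟨m, hm, h⟩ := hq.exists_point_mul_mem
        (D := D ∩ 𝔾.ball l) ⟨hD.1.inter hl.1, Set.subset_inter hD.2 hl.2⟩ g
      have h1 := Set.pow_subset_pow_left (n := 2) (Set.mul_subset_mul
        (Set.inv_subset_inv.2 (Set.inter_subset_left : D ∩ 𝔾.ball l ⊆ D)) Set.inter_subset_left) h
      have h2 := Set.pow_subset_pow_left (n := 2) (Set.mul_subset_mul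
        (Set.inv_subset_inv.2 (Set.inter_subset_right : D ∩ 𝔾.ball l ⊆ _)) Set.inter_subset_right) h
      refine ⟨fun _ => m, ⟨h1, key D hD m hm⟩, fun _ => ?_⟩
      simpa using 𝔾.mul_mem _ _ _ _ hk (𝔾.inv_mem _ _ (hN h2)))
  have h1 : (m ())⁻¹ * g ∈ hq.subgroup := hq.mem_subgroup_iff.2 fun D hD => (hm D hD).1
  have h2 : (m ())⁻¹ * (a⁻¹ * c) * m () ∈ hq.subgroup :=
    hq.mem_subgroup_iff.2 fun D hD => (hm D hD).2
  have h3 := mul_mem (mul_mem (inv_mem h1) h2) h1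
  convert h3 using 1
  group

/-- With `c` a coheir over both `a` and `b`, write `a⁻¹ * b = (a⁻¹ * c) * (b⁻¹ * c)⁻¹`; the
conjugates of both factors are in the group. -/
theorem normal : hq.subgroup.Normal := by
  have key : ∀ a ∈ q, ∀ b ∈ q, ∀ g : G, g⁻¹ * (a⁻¹ * b) * g ∈ hq.subgroup := by
    intro a ha b hb g
    obtain ⟨𝒰, h𝒰⟩ := exists_isCoheir (𝔾 := 𝔾) fun _ : Unit => a
    obtain ⟨n, hn⟩ := h𝒰.exists_ball
    obtain ⟨c, hc⟩ := exists_realizesAv hn (Set.to_countable {a, b})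
    have h1 := hq.conj_mem_of_coheir h𝒰 (SameTp.refl _) (c := c ())
      (hc.mono (Set.union_subset_union_right _ (by simp))) g
    have h2 := hq.conj_mem_of_coheir h𝒰 (hq.sameTp a ha b hb) (c := c ())
      (hc.mono (Set.union_subset_union_right _ (by simp))) g
    have := mul_mem h1 (inv_mem h2)
    convert this using 1
    group
  refine ⟨fun x hx g => ?_⟩
  rw [mem_subgroup, pow_two] at hx
  obtain ⟨_, ⟨a, ha, b, hb, rfl⟩, _, ⟨c, hc, d, hd, rfl⟩, rfl⟩ := hx
  have := mul_mem (key _ ha b hb g⁻¹) (key _ hc d hd g⁻¹)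
  convert this using 1
  group

theorem not_subset_of_mem {D : Set G} (hD : D ∈ μ.sets) : ¬ (hq.subgroup : Set G) ⊆ D := by
  obtain ⟨a, ha⟩ := hq.nonempty
  exact fun h => hq.wide _ (μ.mul_left D hD a⁻¹) fun b hb => h (hq.inv_mul_mem_subgroup ha hb)

theorem exists_isDef_mem {g : G} (hg : g ∈ hq.subgroup) (hg' : g ∉ q⁻¹ * q) :
    ∃ D ∈ μ.sets, 𝔾.Def {v : Unit → G | v () ∈ D} ∧ g ∈ D := by
  by_contra! h
  exact hg' (hq.stab_subset (hq.mem_stab_of_wide hg fun D hD hD' => h D hD hD'.def_of_empty))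

end IsWideType

end S1Ideal

/-! ### Definable sets, compactness and saturation in the universal domain. -/

namespace StabilizerThm

universe u v w

variable {L : FirstOrder.Language.{u, v}} {U : Type w} [L.Structure U] {A : Set U} {α β : Type*}

theorem exists_formula_of_definable {s : Set (α → U)} (hs : A.Definable L s) :
    ∃ (m : ℕ) (φ : L.Formula (α ⊕ Fin m)) (c : Fin m → U), (∀ j, c j ∈ A) ∧
      s = {x | φ.Realize (Sum.elim x c)} := by
  obtain ⟨A₀, hA₀, h⟩ := Set.definable_iff_finitely_definable.1 hs
  obtain ⟨φ, rfl⟩ := Set.definable_iff_exists_formula_sum.1 h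
  obtain ⟨m, ⟨e⟩⟩ := Finite.exists_equiv_fin (A₀ : Set U)
  refine ⟨m, φ.relabel (Sum.elim (fun a => Sum.inr (e a)) Sum.inl), fun j => e.symm j,
    fun j => hA₀ (e.symm j).2, ?_⟩
  ext x
  simp only [Set.mem_ofPred_eq, Formula.realize_relabel]
  refine iff_of_eq (congrArg _ ?_)
  ext (a | i) <;> simp

theorem definable_fiber {s : Set (α ⊕ β → U)} (hs : A.Definable L s) {c : β → U}
    (hc : ∀ j, c j ∈ A) : A.Definable L {x : α → U | Sum.elim x c ∈ s} := by
  obtain ⟨φ, rfl⟩ := Set.definable_iff_exists_formula_sum.1 hs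
  refine Set.definable_iff_exists_formula_sum.2 ⟨φ.relabel (Sum.elim Sum.inl
    (Sum.elim Sum.inr fun b => Sum.inl ⟨c b, hc b⟩)), ?_⟩
  ext x
  simp only [Set.mem_ofPred_eq, Formula.realize_relabel]
  refine iff_of_eq (congrArg _ ?_)
  ext (a | i | j) <;> simp

/-- The existential closure of a defining formula has its parameters in `M`, so it holds in `M` too.
-/
theorem exists_mem_elementarySubstructure (M : L.ElementarySubstructure U) [Finite α]
    {s : Set (α → U)} (hs : (M : Set U).Definable L s) (h : s.Nonempty) :
    ∃ x ∈ s, ∀ i, x i ∈ M := by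
  obtain ⟨φ, rfl⟩ := Set.definable_iff_exists_formula_sum.1 hs
  obtain ⟨x, hx⟩ := h
  have h1 : (φ.iExs α).Realize (fun a : ((M : Set U) : Type w) => (a : U)) := Formula.realize_iExs.2 ⟨x, hx⟩
  have h2 : (φ.iExs α).Realize (id : M → M) := (M.subtype.map_formula (φ.iExs α) id).1 h1
  obtain ⟨y, hy⟩ := Formula.realize_iExs.1 h2
  refine ⟨fun i => y i, ?_, fun i => (y i).2⟩
  have h3 := (M.subtype.map_formula φ _).2 hy
  rw [Set.mem_ofPred_eq]
  convert h3 using 1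
  ext (a | i) <;> rfl

theorem comp_mem_iff_of_fixes {s : Set (α → U)} (hs : A.Definable L s) (σ : U ≃[L] U)
    (hσ : ∀ a ∈ A, σ a = a) (x : α → U) : (fun i => σ (x i)) ∈ s ↔ x ∈ s := by
  obtain ⟨φ, rfl⟩ := Set.definable_iff_exists_formula_sum.1 hs
  simp only [Set.mem_ofPred_eq]
  rw [← StrongHomClass.realize_formula σ φ (v := Sum.elim _ x)]
  refine iff_of_eq (congrArg _ ?_)
  ext (a | i)
  · simp [hσ a a.2]
  · simp

theorem sameType_iff {a b : α → U} :
    SameType L A a b ↔ ∀ s : Set (α → U), A.Definable L s → (a ∈ s ↔ b ∈ s) := by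
  constructor
  · rintro h _ ⟨φ, rfl⟩
    exact h φ
  · exact fun h φ => h _ ⟨φ, rfl⟩

variable [Nonempty U]

/-- The defining formulas, with the variables read as constants, are finitely satisfiable in `U`
itself; compactness and a completion give the type. -/
theorem exists_typeOver_of_finite_inter {n : ℕ} {J : Type*} (s : J → Set (Fin n → U))
    (hs : ∀ j, A.Definable L (s j)) (h : ∀ t : Finset J, ∃ x, ∀ j ∈ t, x ∈ s j) :
    ∃ p : TypeOver L A (Fin n), ∀ x ∈ p.realizations, ∀ j, x ∈ s j := by
  classical
  let S : L[[A]][[Fin n]].Theory :=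
    {ψ | ∃ j, ∃ φ : L[[A]].Formula (Fin n), {x | φ.Realize x} = s j ∧ Formula.equivSentence φ = ψ}
  have hsat : ((L[[A]].lhomWithConstants (Fin n)).onTheory (L[[A]].completeTheory U) ∪
      S).IsSatisfiable := by
    rw [Theory.isSatisfiable_iff_isFinitelySatisfiable]
    intro T₀ hT₀
    choose j φ hφ hψ using fun ψ : S => ψ.2
    obtain ⟨x, hx⟩ := h ((T₀.subtype (· ∈ S)).image j)
    let := constantsOn.structure x
    have : U ⊨ (T₀ : L[[A]][[Fin n]].Theory) := by
      refine ⟨fun ψ hψT => ?_⟩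
      by_cases hψS : ψ ∈ S
      · have h1 := hx (j ⟨ψ, hψS⟩) (Finset.mem_image_of_mem j (Finset.mem_subtype.2 hψT))
        rw [← hφ ⟨ψ, hψS⟩] at h1
        have h2 := hψ ⟨ψ, hψS⟩
        dsimp only at h2
        rw [← h2, Formula.realize_equivSentence]
        exact h1
      · obtain ⟨χ, hχ, rfl⟩ := (hT₀ hψT).resolve_right hψS
        exact (LHom.realize_onSentence U _ _).2 hχ
    exact Theory.Model.isSatisfiable U
  have hne := mt (Theory.CompleteType.setOfPred_subset_eq_empty_iff (T := L[[A]].completeTheory U) (S := S)).1 (not_not.2 hsat)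
  obtain ⟨p, hp⟩ := Set.nonempty_iff_ne_empty.2 hne
  refine ⟨p, fun x hx j => ?_⟩
  obtain ⟨φ, hφ⟩ := hs j
  have h1 : Formula.equivSentence φ ∈ p := hp ⟨j, φ, hφ.symm, rfl⟩
  have h2 : Theory.typeOf (L[[A]].completeTheory U) x = p := hx
  rw [← h2, Theory.CompleteType.formula_mem_typeOf] at h1
  rw [hφ]
  exact h1

theorem IsUniversalDomain.exists_forall_mem {κ : Cardinal.{w}} (hU : IsUniversalDomain L U κ)
    (hA : #A < κ) [Finite α] {J : Type*} (s : J → Set (α → U)) (hs : ∀ j, A.Definable L (s j))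
    (h : ∀ t : Finset J, ∃ x, ∀ j ∈ t, x ∈ s j) : ∃ x, ∀ j, x ∈ s j := by
  obtain ⟨n, ⟨e⟩⟩ := Finite.exists_equiv_fin α
  obtain ⟨p, hp⟩ := exists_typeOver_of_finite_inter (L := L) (A := A)
    (fun j => (fun g : Fin n → U => g ∘ e) ⁻¹' s j) (fun j => (hs j).preimage_comp e)
    (fun t => by
      obtain ⟨x, hx⟩ := h t
      exact ⟨x ∘ e.symm, fun j hj => by simpa [Function.comp_assoc] using hx j hj⟩)
  obtain ⟨x, hx⟩ := hU.saturated A hA n p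
  exact ⟨x ∘ e, fun j => hp x hx j⟩

theorem IsUniversalDomain.exists_equiv {κ : Cardinal.{w}} (hU : IsUniversalDomain L U κ)
    (hA : #A < κ) [Finite α] {c d : α → U} (h : SameType L A c d) :
    ∃ σ : U ≃[L] U, (∀ a ∈ A, σ a = a) ∧ ∀ i, σ (c i) = d i := by
  obtain ⟨n, ⟨e⟩⟩ := Finite.exists_equiv_fin α
  obtain ⟨σ, hσ, hσ'⟩ := hU.homogeneous A hA n (c ∘ e.symm) (d ∘ e.symm)
    (sameType_iff.2 fun s hs => sameType_iff.1 h _ (hs.preimage_comp e.symm))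
  exact ⟨σ, hσ, fun i => by simpa using hσ' (e i)⟩

theorem typeOf_eq_typeOf_iff {a b : α → U} :
    Theory.typeOf (L[[A]].completeTheory U) a = Theory.typeOf (L[[A]].completeTheory U) b ↔
      SameType L A a b := by
  constructor
  · intro h φ
    rw [← Theory.CompleteType.formula_mem_typeOf (T := L[[A]].completeTheory U), h,
      Theory.CompleteType.formula_mem_typeOf]
  · intro h
    refine SetLike.ext fun ψ => ?_
    obtain ⟨φ, rfl⟩ := Formula.equivSentence.surjective ψ
    rw [Theory.CompleteType.formula_mem_typeOf, Theory.CompleteType.formula_mem_typeOf]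
    exact h φ

end StabilizerThm

/-! ### The ind-definable group satisfies the abstract calculus. -/

namespace StabilizerThm

universe u v w

variable {L : FirstOrder.Language.{u, v}} {U : Type w} [L.Structure U]
  {k : ℕ} {G : Set (Fin k → U)}

/-- The coordinates of a tuple of elements of `G`. -/
def flat {ι : Type*} (g : ι → G) : ι × Fin k → U := fun p => (g p.1 : Fin k → U) p.2

theorem flat_injective {ι : Type*} : Function.Injective (flat : (ι → G) → ι × Fin k → U) := by
  intro g h hgh
  ext i j
  exact congrFun hgh (i, j)

theorem mk_union_iUnion_lt {M : Set U} {κ : Cardinal.{w}} (hκ : ℵ₀ < κ) (hM : #M < κ) {C : Set G}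
    (hC : C.Countable) : #(M ∪ ⋃ c ∈ C, Set.range (c : Fin k → U) : Set U) < κ := by
  refine (mk_union_le _ _).trans_lt (add_lt_of_lt hκ.le hM (lt_of_le_of_lt ?_ hκ))
  rw [le_aleph0_iff_set_countable]
  exact hC.biUnion fun c _ => Set.countable_range _

variable [Group G] {X : Set G}

theorem ball_mono : Monotone (ball X) := fun _ _ h =>
  Set.pow_subset_pow_right (Set.mem_insert _ _) h

theorem mul_mem_ball (m n : ℕ) (g h : G) (hg : g ∈ ball X m) (hh : h ∈ ball X n) :
    g * h ∈ ball X (m + n) := by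
  rw [ball, pow_add]
  exact Set.mul_mem_mul hg hh

theorem inv_mem_ball (n : ℕ) (g : G) (hg : g ∈ ball X n) : g⁻¹ ∈ ball X n := by
  have h : (ball X n)⁻¹ = ball X n := by
    rw [ball, ← inv_pow]
    simp [Set.union_comm]
  rw [← h]
  simpa using hg

theorem IsIndDefinableGroup.exists_mem_ball {A : Set U} (hG : IsIndDefinableGroup L A X) (g : G) :
    ∃ n, g ∈ ball X n := by
  have hg : g ∈ Subgroup.closure X := hG.generates ▸ Subgroup.mem_top g
  induction hg using Subgroup.closure_induction with
  | mem x hx => exact ⟨1, by simp [ball, hx]⟩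
  | one => exact ⟨0, by simp [ball]⟩
  | mul x y _ _ hx hy =>
    obtain ⟨m, hm⟩ := hx
    obtain ⟨n, hn⟩ := hy
    exact ⟨m + n, mul_mem_ball _ _ _ _ hm hn⟩
  | inv x _ hx => exact hx.imp fun n => inv_mem_ball n x

theorem IsIndDefinableGroup.exists_forall_mem_ball {A : Set U} (hG : IsIndDefinableGroup L A X)
    {ι : Type*} [Finite ι] (g : ι → G) : ∃ n, ∀ i, g i ∈ ball X n := by
  choose N hN using fun i => hG.exists_mem_ball (g i)
  obtain ⟨N', hN'⟩ := (Set.finite_range N).bddAbove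
  exact ⟨N', fun i => ball_mono (hN' ⟨i, rfl⟩) (hN i)⟩

variable (X) in
/-- The tuples of elements of `(X ∪ X⁻¹)^{≤ n}`. -/
def tupleBall (ι : Type*) (n : ℕ) : Set (ι → G) := {g | ∀ i, g i ∈ ball X n}

variable (L X) in
/-- The intersections of `P` with the powers of the sets `(X ∪ X⁻¹)^{≤ n}` are `A`-definable. -/
def LocDef (A : Set U) {ι : Type*} (P : Set (ι → G)) : Prop :=
  ∀ n, A.Definable L (flat '' (P ∩ tupleBall X ι n))

variable {A B : Set U} {ι κ : Type*}

theorem IsIndDefinableGroup.definable_tupleBall [Finite ι] (hG : IsIndDefinableGroup L A X)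
    (n : ℕ) : A.Definable L (flat '' tupleBall X ι n) := by
  have h := Set.definable_iInter_of_finite fun i : ι =>
    (hG.definable_ball n).preimage_comp fun j : Fin k => (i, j)
  convert h using 1
  ext v
  simp only [Set.mem_image, Set.mem_iInter, Set.mem_preimage]
  constructor
  · rintro ⟨g, hg, rfl⟩ i
    exact ⟨g i, hg i, rfl⟩
  · intro h
    choose g hg hv using h
    exact ⟨g, hg, funext fun p => congrFun (hv p.1) p.2⟩

namespace LocDef

theorem univ [Finite ι] (hG : IsIndDefinableGroup L A X) :
    LocDef L X A (Set.univ : Set (ι → G)) := fun n => by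
  simpa using hG.definable_tupleBall n

theorem inter {P Q : Set (ι → G)} (hP : LocDef L X A P) (hQ : LocDef L X A Q) :
    LocDef L X A (P ∩ Q) := fun n => by
  rw [Set.inter_inter_distrib_right, Set.image_inter flat_injective]
  exact (hP n).inter (hQ n)

theorem compl [Finite ι] (hG : IsIndDefinableGroup L A X) {P : Set (ι → G)}
    (hP : LocDef L X A P) : LocDef L X A Pᶜ := fun n => by
  convert (hG.definable_tupleBall n).sdiff (hP n) using 1
  rw [← Set.image_sdiff flat_injective]
  congr 1
  ext g
  simp only [Set.mem_inter_iff, Set.mem_compl_iff, Set.mem_sdiff]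
  tauto

theorem comp [Finite κ] (hG : IsIndDefinableGroup L A X) {P : Set (ι → G)}
    (hP : LocDef L X A P) (σ : ι → κ) : LocDef L X A {g : κ → G | g ∘ σ ∈ P} := fun n => by
  convert (hG.definable_tupleBall n).inter ((hP n).preimage_comp (Prod.map σ id)) using 1
  ext v
  constructor
  · rintro ⟨g, ⟨hg, hgn⟩, rfl⟩
    exact ⟨⟨g, hgn, rfl⟩, g ∘ σ, ⟨hg, fun i => hgn _⟩, rfl⟩
  · rintro ⟨⟨g, hgn, rfl⟩, h, ⟨hh, -⟩, hgh⟩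
    obtain rfl : h = g ∘ σ := flat_injective hgh
    exact ⟨g, ⟨hh, hgn⟩, rfl⟩

theorem ex [Finite ι] [Finite κ] (hG : IsIndDefinableGroup L A X) (n : ℕ) {P : Set (ι ⊕ κ → G)}
    (hP : LocDef L X A P) :
    LocDef L X A {g : ι → G | ∃ h : κ → G, (∀ j, h j ∈ ball X n) ∧ Sum.elim g h ∈ P} := fun N => by
  have h := ((hP (max N n)).inter (((hG.definable_tupleBall (ι := ι) N).preimage_comp
    (Prod.map Sum.inl id)).inter ((hG.definable_tupleBall (ι := κ) n).preimage_comp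
    (Prod.map Sum.inr id)))).image_comp (Prod.map (Sum.inl : ι → ι ⊕ κ) (id : Fin k → Fin k))
  convert h using 1
  ext v
  constructor
  · rintro ⟨g, ⟨⟨h, hh, hP⟩, hg⟩, rfl⟩
    refine ⟨flat (Sum.elim g h), ⟨⟨_, ⟨hP, ?_⟩, rfl⟩, ⟨g, hg, rfl⟩, h, hh, rfl⟩, rfl⟩
    rintro (i | j)
    · exact ball_mono (le_max_left _ _) (hg i)
    · exact ball_mono (le_max_right _ _) (hh j)
  · rintro ⟨_, ⟨⟨w, ⟨hw, -⟩, rfl⟩, ⟨g, hg, hgw⟩, h, hh, hhw⟩, rfl⟩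
    obtain rfl : g = w ∘ Sum.inl := flat_injective hgw
    obtain rfl : h = w ∘ Sum.inr := flat_injective hhw
    exact ⟨_, ⟨⟨_, hh, by simpa using hw⟩, hg⟩, rfl⟩

theorem of_local {P : Set (ι → G)} (h : ∀ n, LocDef L X A (P ∩ {g | ∀ i, g i ∈ ball X n})) :
    LocDef L X A P := fun n => by
  have h1 := h n n
  rw [Set.inter_assoc] at h1
  change A.Definable L (flat '' (P ∩ (tupleBall X ι n ∩ tupleBall X ι n))) at h1
  rwa [Set.inter_self] at h1

theorem mul_graph (hG : IsIndDefinableGroup L A X) :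
    LocDef L X A {g : Fin 3 → G | g 0 * g 1 = g 2} := fun n => by
  convert (hG.definable_mul n).inter (hG.definable_tupleBall (ι := Fin 3) n) using 1
  ext v
  constructor
  · rintro ⟨g, ⟨hg, hgn⟩, rfl⟩
    refine ⟨⟨g 0, hgn 0, g 1, hgn 1, rfl, rfl, ?_⟩, g, hgn, rfl⟩
    have : g 0 * g 1 = g 2 := hg
    rw [this]
    rfl
  · rintro ⟨⟨a, -, b, -, h1, h2, h3⟩, g, hg, rfl⟩
    obtain rfl : g 0 = a := Subtype.ext h1
    obtain rfl : g 1 = b := Subtype.ext h2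
    exact ⟨g, ⟨(Subtype.ext h3).symm, hg⟩, rfl⟩

theorem of_definable (hG : IsIndDefinableGroup L A X) {D : Set G}
    (hD : A.Definable L ((↑) '' D : Set (Fin k → U))) :
    LocDef L X A {g : Unit → G | g () ∈ D} := fun n => by
  convert (hD.preimage_comp fun j : Fin k => ((), j)).inter (hG.definable_tupleBall n) using 1
  ext v
  constructor
  · rintro ⟨g, ⟨hg, hgn⟩, rfl⟩
    exact ⟨⟨g (), hg, rfl⟩, g, hgn, rfl⟩
  · rintro ⟨⟨x, hx, hxg⟩, g, hg, rfl⟩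
    obtain rfl : x = g () := Subtype.ext hxg
    exact ⟨g, ⟨hx, hg⟩, rfl⟩

theorem fiber [Finite ι] [Finite κ] (hG : IsIndDefinableGroup L A X) {P : Set (ι ⊕ κ → G)}
    (hP : LocDef L X A P) (hAB : A ⊆ B) {e : κ → G} (he : ∀ p, flat e p ∈ B) :
    LocDef L X B {g : ι → G | Sum.elim g e ∈ P} := fun n => by
  obtain ⟨N, hN⟩ := hG.exists_forall_mem_ball e
  have h1 := ((hP (max n N)).mono hAB).preimage_comp (Equiv.sumProdDistrib ι κ (Fin k))
  convert (definable_fiber h1 he).inter ((hG.definable_tupleBall n).mono hAB) using 1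
  have key : ∀ g : ι → G, Sum.elim (flat g) (flat e) ∘ Equiv.sumProdDistrib ι κ (Fin k) =
      flat (Sum.elim g e) := by
    intro g
    ext ⟨i | j, l⟩ <;> rfl
  ext v
  constructor
  · rintro ⟨g, ⟨hg, hgn⟩, rfl⟩
    refine ⟨⟨_, ⟨hg, ?_⟩, (key g).symm⟩, g, hgn, rfl⟩
    rintro (i | j)
    · exact ball_mono (le_max_left _ _) (hgn i)
    · exact ball_mono (le_max_right _ _) (hN j)
  · rintro ⟨⟨w, ⟨hw, -⟩, hwg⟩, g, hg, rfl⟩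
    obtain rfl : w = Sum.elim g e := flat_injective (hwg.trans (key g))
    exact ⟨g, ⟨hw, hg⟩, rfl⟩

theorem definable_image {D : Set G} (hD : LocDef L X A {g : Unit → G | g () ∈ D}) {n : ℕ}
    (hn : D ⊆ ball X n) : A.Definable L ((↑) '' D : Set (Fin k → U)) := by
  convert (hD n).preimage_comp (Prod.snd : Unit × Fin k → Fin k) using 1
  ext v
  constructor
  · rintro ⟨x, hx, rfl⟩
    exact ⟨fun _ => x, ⟨hx, fun _ => hn hx⟩, rfl⟩
  · rintro ⟨g, ⟨hg, -⟩, hgv⟩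
    exact ⟨g (), hg, funext fun j => congrFun hgv ((), j)⟩

theorem of_definable_flat [Finite ι] (hG : IsIndDefinableGroup L A X) {s : Set (ι × Fin k → U)}
    (hs : A.Definable L s) : LocDef L X A {g : ι → G | flat g ∈ s} := fun n => by
  convert hs.inter (hG.definable_tupleBall n) using 1
  ext v
  constructor
  · rintro ⟨g, ⟨hg, hgn⟩, rfl⟩
    exact ⟨hg, g, hgn, rfl⟩
  · rintro ⟨hv, g, hg, rfl⟩
    exact ⟨g, ⟨hv, hg⟩, rfl⟩

end LocDef

/-- The locally definable sets of an ind-definable group. -/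
def IsIndDefinableGroup.locDefGroup [Nonempty U] {κ : Cardinal.{w}} (hκ : ℵ₀ < κ)
    (hU : IsUniversalDomain L U κ) (M : L.ElementarySubstructure U) (hM : #M < κ)
    (hG : IsIndDefinableGroup L (M : Set U) X) : LocDefGroup G where
  ball := ball X
  ball_mono := ball_mono
  exists_ball := hG.exists_mem_ball
  mul_mem := mul_mem_ball
  inv_mem := inv_mem_ball
  Def P := LocDef L X (M : Set U) P
  points := {g | ∀ j, (g : Fin k → U) j ∈ M}
  univ := LocDef.univ hG
  inter _ _ := LocDef.inter
  compl _ := LocDef.compl hG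
  comp _ σ h := h.comp hG σ
  ex n _ := LocDef.ex hG n
  of_local _ := LocDef.of_local
  mul_graph := LocDef.mul_graph hG
  def_ball n := LocDef.of_definable hG (hG.definable_ball n)
  exists_point := by
    rintro ι _ P hP ⟨g, hg⟩
    obtain ⟨n, hn⟩ := hG.exists_forall_mem_ball g
    obtain ⟨_, ⟨h, ⟨hh, -⟩, rfl⟩, hM⟩ :=
      exists_mem_elementarySubstructure M (hP n) ⟨_, g, ⟨hg, hn⟩, rfl⟩
    exact ⟨h, hh, fun i j => hM (i, j)⟩
  fiber_point P e hP he := hP.fiber hG subset_rfl fun p => he p.1 p.2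
  sat := by
    intro ι _ C n 𝓕 hC hdef hfin
    let A : Set U := (M : Set U) ∪ ⋃ c ∈ C, Set.range (c : Fin k → U)
    have hA : #A < κ := mk_union_iUnion_lt hκ hM hC
    -- The full set is added to the family so that the realization is a tuple from the ball, even
    -- when `𝓕` is empty.
    obtain ⟨v, hv⟩ := hU.exists_forall_mem hA (J := (insert Set.univ 𝓕 : Set (Set (ι → G))))
      (fun Q => flat '' (Q.1 ∩ tupleBall X ι n)) (by
        rintro ⟨Q, rfl | hQ⟩
        · exact (LocDef.univ hG n).mono Set.subset_union_left
        · obtain ⟨m, P, e, hP, he, rfl⟩ := hdef Q hQ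
          refine hP.fiber hG (B := A) Set.subset_union_left (fun p => ?_) n
          rcases he p.1 with h | h
          · exact Or.inl (h p.2)
          · exact Or.inr (Set.mem_biUnion h ⟨p.2, rfl⟩)) (by
        intro t
        obtain ⟨g, hgn, hg⟩ := hfin _
          ((t.finite_toSet.image Subtype.val).inter_of_left 𝓕) Set.inter_subset_right
        refine ⟨flat g, ?_⟩
        rintro ⟨Q, rfl | hQ⟩ hQt
        · exact ⟨g, ⟨trivial, hgn⟩, rfl⟩
        · exact ⟨g, ⟨hg Q ⟨⟨_, hQt, rfl⟩, hQ⟩, hgn⟩, rfl⟩)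
    obtain ⟨g, ⟨-, hgn⟩, rfl⟩ := hv ⟨Set.univ, Set.mem_insert _ _⟩
    refine ⟨g, hgn, fun Q hQ => ?_⟩
    obtain ⟨h, ⟨hh, -⟩, hgh⟩ := hv ⟨Q, Set.mem_insert_of_mem _ hQ⟩
    exact flat_injective hgh ▸ hh

end StabilizerThm

/-! ### Transfer of types, indiscernibility and the ideal. -/

namespace StabilizerThm

universe u v w

variable {L : FirstOrder.Language.{u, v}} {U : Type w} [L.Structure U] [Nonempty U]
  {k : ℕ} {G : Set (Fin k → U)} [Group G] {X : Set G} {κ : Cardinal.{w}} (hκ : ℵ₀ < κ)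
  (hU : IsUniversalDomain L U κ) {M : L.ElementarySubstructure U} (hM : #M < κ)
  (hG : IsIndDefinableGroup L (M : Set U) X)

theorem definable_iff_of_sameTp {ι : Type} [Finite ι] {a b : ι → G}
    (h : (hG.locDefGroup hκ hU M hM).SameTp a b) {s : Set (ι × Fin k → U)}
    (hs : (M : Set U).Definable L s) : flat a ∈ s ↔ flat b ∈ s :=
  h _ (LocDef.of_definable_flat hG hs)

theorem sameTp_of_sameType {a b : G}
    (h : SameType L (M : Set U) (a : Fin k → U) (b : Fin k → U)) :
    (hG.locDefGroup hκ hU M hM).SameTp (fun _ : Unit => a) (fun _ => b) := by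
  intro P hP
  obtain ⟨m, hm⟩ := hG.exists_mem_ball a
  obtain ⟨n, hn⟩ := hG.exists_mem_ball b
  have h1 := sameType_iff.1 h _ ((hP (max m n)).preimage_comp (Prod.snd : Unit × Fin k → Fin k))
  have key : ∀ c : G, c ∈ ball X (max m n) → ((fun _ => c) ∈ P ↔ (c : Fin k → U) ∈
      (fun g : Fin k → U => g ∘ (Prod.snd : Unit × Fin k → Fin k)) ⁻¹'
        (flat '' (P ∩ tupleBall X Unit (max m n)))) := by
    intro c hc
    constructor
    · exact fun h => ⟨fun _ => c, ⟨h, fun _ => hc⟩, rfl⟩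
    · rintro ⟨g, ⟨hg, -⟩, hgc⟩
      obtain rfl : g = fun _ => c := flat_injective hgc
      exact hg
  rw [key a (ball_mono (le_max_left _ _) hm), key b (ball_mono (le_max_right _ _) hn)]
  exact h1

theorem sameType_of_sameTp {a b : G}
    (h : (hG.locDefGroup hκ hU M hM).SameTp (fun _ : Unit => a) (fun _ => b)) :
    SameType L (M : Set U) (a : Fin k → U) (b : Fin k → U) :=
  sameType_iff.2 fun _ hs =>
    definable_iff_of_sameTp hκ hU hM hG h (hs.preimage_comp fun j : Fin k => ((), j))

theorem exists_coe_eq_comp {β : Type} [Finite β] {F : (β → G) → Set G}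
    (hF : (hG.locDefGroup hκ hU M hM).Fam F) {e e' : β → G} (σ : U ≃[L] U)
    (hσ : ∀ a ∈ (M : Set U), σ a = a) (hσe : ∀ p, σ (flat e p) = flat e' p) {x : G} (hx : x ∈ F e) :
    ∃ y ∈ F e', (y : Fin k → U) = fun j => σ ((x : Fin k → U) j) := by
  let w : Unit ⊕ β → G := Sum.elim (fun _ => x) e
  obtain ⟨n, hn⟩ := hG.exists_forall_mem_ball w
  obtain ⟨z, ⟨hz, -⟩, hzw⟩ := (comp_mem_iff_of_fixes (hF n) σ hσ (flat w)).2 ⟨w, ⟨hx, hn⟩, rfl⟩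
  have h1 : z ∘ Sum.inr = e' := by
    apply flat_injective
    ext p
    exact (congrFun hzw (Sum.inr p.1, p.2)).trans (hσe p)
  refine ⟨z (Sum.inl ()), ?_, ?_⟩
  · rw [← h1]
    exact hz
  · ext j
    exact congrFun hzw (Sum.inl (), j)

/-- `IsS1` uses formulas without parameters, so the constants from `M` are appended to every term
and the coordinates are renumbered by `e`. -/
theorem indiscernible_of_indisc {β : Type} [Finite β] {b : ℕ → β → G}
    (hb : (hG.locDefGroup hκ hU M hM).Indisc b) {m l : ℕ} {c : Fin l → U}
    (hc : ∀ j, c j ∈ (M : Set U)) (e : Fin m → (β × Fin k) ⊕ Fin l) :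
    Indiscernible L (M : Set U) fun i j => Sum.elim (flat (b i)) c (e j) := by
  intro n s t hs ht
  rw [sameType_iff]
  intro E hE
  have h1 := definable_fiber (hE.preimage_comp (fun p : Fin n × Fin m =>
    Sum.elim (fun x : β × Fin k => Sum.inl (((p.1, x.1), x.2) : (Fin n × β) × Fin k))
      (Sum.inr : Fin l → _) (e p.2))) hc
  have h2 := definable_iff_of_sameTp hκ hU hM hG (hb n s t hs ht) h1
  have key : ∀ s : Fin n → ℕ, Sum.elim (flat fun p : Fin n × β => b (s p.1) p.2) c ∘
      (fun p : Fin n × Fin m =>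
    Sum.elim (fun x : β × Fin k => Sum.inl (((p.1, x.1), x.2) : (Fin n × β) × Fin k))
      (Sum.inr : Fin l → _) (e p.2)) =
      fun p : Fin n × Fin m => Sum.elim (flat (b (s p.1))) c (e p.2) := by
    intro s
    ext p
    simp only [Function.comp_apply]
    rcases e p.2 with x | x <;> rfl
  simp only [Set.mem_ofPred_eq, Set.mem_preimage, key] at h2
  exact h2

variable {μ : Set (Set G)}

/-- The S1 ideal of definable subsets of an ind-definable group. -/
def IsDefinableIdeal.s1Ideal (hμ : IsDefinableIdeal L X μ) (hμM : IsAutInvariant L (M : Set U) μ)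
    (hμS1 : IsS1 L (M : Set U) X μ) (hμG : IsTranslationInvariant μ) :
    S1Ideal (hG.locDefGroup hκ hU M hM) where
  sets := μ
  empty_mem := hμ.empty_mem
  union_mem := hμ.union_mem
  mono D hD E hE hED := by
    obtain ⟨n, hn⟩ := (hμ.definable D hD).2
    obtain ⟨m, P, e, hP, -, hPE⟩ := hE
    have h1 : LocDef L X Set.univ {v : Unit → G | v () ∈ E} := by
      rw [hPE]
      exact LocDef.fiber hG hP (Set.subset_univ _) fun _ => trivial
    exact hμ.mono D hD E ⟨h1.definable_image (hED.trans hn), n, hED.trans hn⟩ hED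
  inv := by
    intro β _ F e e' hF hee he
    -- Equality of types is turned into an automorphism over `M`, which carries `F e` onto `F e'`.
    obtain ⟨σ, hσ, hσe⟩ := hU.exists_equiv hM (c := flat e) (d := flat e')
      (sameType_iff.2 fun s hs => definable_iff_of_sameTp hκ hU hM hG hee hs)
    refine hμM σ hσ _ he _ ?_
    ext x
    constructor
    · rintro ⟨y, hy, rfl⟩
      obtain ⟨z, hz, hzy⟩ := exists_coe_eq_comp hκ hU hM hG hF (e' := e) σ.symm
        (fun a ha => by
          conv_lhs => rw [← hσ a ha]
          exact σ.symm_apply_apply a)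
        (fun p => by
          rw [← hσe p]
          exact σ.symm_apply_apply _) hy
      refine ⟨z, ⟨z, hz, rfl⟩, ?_⟩
      ext j
      dsimp only
      rw [hzy]
      exact σ.apply_symm_apply _
    · rintro ⟨_, ⟨y, hy, rfl⟩, rfl⟩
      obtain ⟨z, hz, hzy⟩ := exists_coe_eq_comp hκ hU hM hG hF σ hσ hσe hy
      exact ⟨z, hz, hzy⟩
  s1 := by
    intro β _ F b hF hb hbd hμF
    obtain ⟨n, hn⟩ := hbd
    obtain ⟨N, hN⟩ := hG.exists_forall_mem_ball (b 0)
    have hbN : ∀ i j, b i j ∈ ball X N := fun i j =>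
      (LocDefGroup.Indisc.sameTp hb i 0 _ (LocDefGroup.def_mem_ball j N)).2 (hN j)
    -- One ball, of radius `max n N`, contains all the sets `F (b i)` and all their parameters, so a
    -- single formula defines the whole sequence.
    obtain ⟨l, ψ, c, hc, hψ⟩ := exists_formula_of_definable (hF (max n N))
    obtain ⟨m, ⟨e⟩⟩ := Finite.exists_equiv_fin ((β × Fin k) ⊕ Fin l)
    let φ : L.Formula (Fin k ⊕ Fin m) := ψ.relabel
      (Sum.elim (fun p : (Unit ⊕ β) × Fin k => Sum.elim (fun _ => Sum.inl p.2)
        (fun x => Sum.inr (e (Sum.inl (x, p.2)))) p.1) (fun j => Sum.inr (e (Sum.inr j))))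
    refine hμS1 m φ (fun i j => Sum.elim (flat (b i)) c (e.symm j)) (fun i => F (b i))
      (indiscernible_of_indisc hκ hU hM hG hb hc e.symm) (fun i => ?_) (fun i => ?_) hμF
    · have h1 : LocDef L X Set.univ {v : Unit → G | v () ∈ F (b i)} :=
        LocDef.fiber hG hF (Set.subset_univ _) fun _ => trivial
      exact ⟨h1.definable_image (hn i), n, hn i⟩
    · have key : ∀ x : Fin k → U, x ∈ solutionSet L φ
          (fun j => Sum.elim (flat (b i)) c (e.symm j)) ↔
          (fun p : (Unit ⊕ β) × Fin k => Sum.elim (fun _ => x p.2) (fun y => flat (b i) (y, p.2)) p.1) ∈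
            flat '' ({v : Unit ⊕ β → G | v (Sum.inl ()) ∈ F (v ∘ Sum.inr)} ∩
              tupleBall X (Unit ⊕ β) (max n N)) := by
        intro x
        rw [hψ]
        simp only [solutionSet, Set.mem_ofPred_eq, φ, Formula.realize_relabel]
        refine iff_of_eq (congrArg _ ?_)
        ext (⟨u | y, j⟩ | j) <;> simp
      ext x
      rw [key]
      constructor
      · rintro ⟨g, hg, rfl⟩
        refine ⟨Sum.elim (fun _ => g) (b i), ⟨hg, ?_⟩, ?_⟩
        · rintro (_ | j)
          · exact ball_mono (le_max_left _ _) (hn i hg)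
          · exact ball_mono (le_max_right _ _) (hbN i j)
        · ext ⟨_ | y, j⟩ <;> rfl
      · rintro ⟨w, ⟨hw, -⟩, hwx⟩
        have h1 : w ∘ Sum.inr = b i := by
          apply flat_injective
          ext p
          exact congrFun hwx (Sum.inr p.1, p.2)
        refine ⟨w (Sum.inl ()), ?_, ?_⟩
        · rw [← h1]
          exact hw
        · ext j
          exact congrFun hwx (Sum.inl (), j)
  mul_left D hD g := by
    convert (hμG D hD g⁻¹).1 using 1
    ext x
    simp
  mul_right D hD g := by
    convert (hμG D hD g⁻¹).2 using 1
    ext x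
    simp

end StabilizerThm

/-! ### The stabilizer theorem for the given type and ideal. -/

theorem mainTheorem1 {L : FirstOrder.Language} {U : Type*} [L.Structure U] [Nonempty U]
    (κ : Cardinal) (hκ : ℵ₀ < κ) (hU : IsUniversalDomain L U κ)
    (M : L.ElementarySubstructure U) (hM : #M < κ)
    {k : ℕ} {G : Set (Fin k → U)} [Group G] (X : Set G)
    (hG : IsIndDefinableGroup L (M : Set U) X)
    (μ : Set (Set G)) (hμ : IsDefinableIdeal L X μ) (hμM : IsAutInvariant L (M : Set U) μ)
    (hμS1 : IsS1 L (M : Set U) X μ) (hμG : IsTranslationInvariant μ)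
    (p : TypeOver L (M : Set U) (Fin k)) (hpG : p.realizations ⊆ G)
    (q : Set G) (hq : q = (↑) ⁻¹' p.realizations) (hwide : IsWide μ q)
    (hF : ∃ a ∈ q, ∃ b ∈ q,
      TypeDoesNotFork L (M : Set U) ((M : Set U) ∪ Set.range (a : Fin k → U))
        (b : Fin k → U) ∧
      TypeDoesNotFork L (M : Set U) ((M : Set U) ∪ Set.range (b : Fin k → U))
        (a : Fin k → U)) :
    ∃ S : Subgroup G,
      (S : Set G) = (q⁻¹ * q) ^ 2 ∧
      IsTypeDefinable L (M : Set U) X (S : Set G) ∧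
      IsWide μ (S : Set G) ∧
      S.Normal ∧
      (∃ g : G, q * q⁻¹ * q = g • (S : Set G)) ∧
      (∃ F : Set (Set G), (∀ D ∈ F, IsDefinableSubset L (M : Set U) X D ∧ ¬ IsWide μ D) ∧
        (S : Set G) \ (q⁻¹ * q) ⊆ ⋃₀ F) := by
  let 𝔾 := hG.locDefGroup hκ hU M hM
  let I : S1Ideal 𝔾 := hμ.s1Ideal hκ hU hM hG hμM hμS1 hμG
  have hmem : ∀ a : G, a ∈ q ↔
      Theory.typeOf (L[[(M : Set U)]].completeTheory U) (a : Fin k → U) = p := fun a => by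
    rw [hq]
    rfl
  have hI : I.IsWideType q :=
    { sameTp := fun a ha b hb => sameTp_of_sameType hκ hU hM hG
        (typeOf_eq_typeOf_iff.1 (((hmem a).1 ha).trans ((hmem b).1 hb).symm))
      mem := fun a ha b hab => (hmem b).2
        ((typeOf_eq_typeOf_iff.2 (sameType_of_sameTp hκ hU hM hG hab)).symm.trans ((hmem a).1 ha))
      wide := hwide }
  have hdef : ∀ D, 𝔾.IsDef D → IsDefinableSubset L (M : Set U) X D := fun D hD =>
    ⟨LocDef.definable_image hD.isDef hD.bdd.choose_spec, hD.bdd⟩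
  obtain ⟨n, hn⟩ := hI.exists_ball
  refine ⟨hI.subgroup, rfl, ⟨{E | ∃ D ∈ S1Ideal.defNhds 𝔾 q, E = (D⁻¹ * D) ^ 2},
    ⟨_, _, hn, rfl⟩, ?_, ?_⟩, fun D hD => hI.not_subset_of_mem hD, hI.normal,
    hI.exists_mul_inv_mul_eq, {D | D ∈ μ ∧ 𝔾.Def {v : Unit → G | v () ∈ D}}, ?_, ?_⟩
  · rintro _ ⟨D, hD, rfl⟩
    exact hdef _ (S1Ideal.isDef_sq hD)
  · ext x
    rw [SetLike.mem_coe, hI.mem_subgroup_iff]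
    constructor
    · rintro hx _ ⟨D, hD, rfl⟩
      exact hx D hD
    · exact fun hx D hD => hx _ ⟨D, hD, rfl⟩
  · rintro D ⟨hD, hD'⟩
    exact ⟨hdef D ⟨hD', (hμ.definable D hD).2⟩, fun h => h D hD subset_rfl⟩
  · rintro g ⟨hg, hg'⟩
    obtain ⟨D, hD, hD', hgD⟩ := hI.exists_isDef_mem hg hg'
    exact ⟨D, ⟨hD, hD'⟩, hgD⟩
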